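/- **Theorem (Schur–Weyl duality for $\mathbb{S}^{[2]}$-modules).** All vector spaces are finite-dimensional over $\mathbb{Q}$; write $\mathsf{Vect}_{\mathbb Q}$ for their category. *Definitions.* An $\mathbb{S}$-module is a finite-dimensional vector space $W=\bigoplus_{n\ge 0}W_n$ with a linear action of the symmetric group $S_n$ on each $W_n$; a morphism is a sequence of $S_n$-equivariant linear maps $f_n\colon U_n\to W_n$. A generalized partition is a finitely supported function $\nu\colon\mathbb{Z}_{\ge 0}\to\mathbb{Z}_{\ge 0}$, $i\mapsto \nu_i$, and $\mathbb{S}_\nu:=\prod_{i\ge 0}S_i\wr S_{\nu_i}$, where $S_m\wr S_n=S_m^n\rtimes S_n$. An $\mathbb{S}^{[2]}$-module is a finite-dimensional vector space $V=\bigoplus_\nu V_\nu$, indexed by the generalized partitions, with a linear action of $\mathbb{S}_\nu$ on each $V_\nu$; a morphism is a family of $\mathbb{S}_\nu$-equivariant linear maps. The group $\mathbb{S}_\nu$ acts on $\bigotimes_{i\ge 0}W_i^{\otimes \nu_i}$: the $j$-th copy of $S_i$ acts on the $j$-th factor $W_i$, and $S_{\nu_i}$ permutes the $\nu_i$ factors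 $W_i$. A functor $F\colon \mathbb{S}\text{-}\mathsf{Vect}_{\mathbb Q}\to\mathsf{Vect}_{\mathbb Q}$ is polynomial if for all $\mathbb{S}$-modules $U,W$ the map $\mathrm{Hom}(U,W)\to\mathrm{Hom}_{\mathbb Q}(F(U),F(W))$, $f\mapsto F(f)$, is a polynomial mapping of vector spaces. It is bounded if there is an $N$ such that for all $U,W$ this map has degree at most $N$ and $F(f)$ depends only on the components $f_0,\dots,f_N$ of $f=(f_n)_{n\ge0}$. Let $\mathbf{P}[\mathbb{S}\text{-}\mathsf{Vect}_{\mathbb Q},\mathsf{Vect}_{\mathbb Q}]$ be the category of bounded polynomial functors, with natural transformations as morphisms. For an $\mathbb{S}^{[2]}$-module $V$ let $$F_V\Bigl(\bigoplus_{n\ge 0} W_n\Bigr)=\bigoplus_{\nu}\mathrm{Hom}_{\mathbb{S}_\nu}\Bigl(V_\nu,\bigotimes_{i\ge 0}W_i^{\otimes\nu_i}\Bigr),$$ a functor of $W$ through postcomposition with $\bigotimes_i f_i^{\otimes \nu_i}$. *Claim.* 1. The assignment $V\mapsto F_V$, which is contravariant in $V$ through precomposition, is an equivalence of categories $(\mathbb{S}^{[2]}\text{-}\mathsf{Vect}_{\mathbb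 Q})^{\mathrm{op}}\to\mathbf{P}[\mathbb{S}\text{-}\mathsf{Vect}_{\mathbb Q},\mathsf{Vect}_{\mathbb Q}]$. 2. There is also a (covariant) equivalence of categories $E\colon\mathbb{S}^{[2]}\text{-}\mathsf{Vect}_{\mathbb Q}\to\mathbf{P}[\mathbb{S}\text{-}\mathsf{Vect}_{\mathbb Q},\mathsf{Vect}_{\mathbb Q}]$ with $E(V)\cong F_V$ as functors for every $\mathbb{S}^{[2]}$-module $V$. -/

import Mathlib

open CategoryTheory
open scoped TensorProduct DirectSum

noncomputable section

namespace SchurWeyl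

/-! ### Finite-dimensional families of representations -/

/-- For a family of groups `G i`, a finite-dimensional rational vector space `⨁ i, V i` together
with a linear action of `G i` on each summand `V i`: every `V i` is finite-dimensional and only
finitely many of them are nonzero. -/
structure RepFamily {ι : Type} (G : ι → Type) [∀ i, Group (G i)] where
  carrier : ι → Type
  [addCommGroup : ∀ i, AddCommGroup (carrier i)]
  [module : ∀ i, Module ℚ (carrier i)]
  [finiteDimensional : ∀ i, Module.Finite ℚ (carrier i)]
  ρ : ∀ i, Representation ℚ (G i) (carrier i)
  finite_support : {i | Nontrivial (carrier i)}.Finite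

attribute [instance] RepFamily.addCommGroup RepFamily.module RepFamily.finiteDimensional

namespace RepFamily

variable {ι : Type} {G : ι → Type} [∀ i, Group (G i)]

/-- Morphisms are families of equivariant linear maps `U i → V i`. -/
instance : Category (RepFamily G) where
  Hom U V := ∀ i, (U.ρ i).IntertwiningMap (V.ρ i)
  id U := fun i => Representation.IntertwiningMap.id (U.ρ i)
  comp f g := fun i => (g i).comp (f i)

instance (U V : RepFamily G) : AddCommGroup (U ⟶ V) :=
  inferInstanceAs (AddCommGroup (∀ i, (U.ρ i).IntertwiningMap (V.ρ i)))

instance (U V : RepFamily G) : Module ℚ (U ⟶ V) :=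
  inferInstanceAs (Module ℚ (∀ i, (U.ρ i).IntertwiningMap (V.ρ i)))

/-- The equivariant linear map `U i → V i` underlying a morphism `U ⟶ V`. -/
def component {U V : RepFamily G} (f : U ⟶ V) (i : ι) : (U.ρ i).IntertwiningMap (V.ρ i) := f i

end RepFamily

/-- `𝕊`-modules over `ℚ`. -/
abbrev SMod : Type 1 := RepFamily (fun n : ℕ => Equiv.Perm (Fin n))

/-- A generalized partition `(0^{ν 0}, 1^{ν 1}, …)`: `ν i` is the number of parts equal to `i`. -/
abbrev GenPartition : Type := ℕ →₀ ℕ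

/-- The wreath product `S_m ≀ S_n = (S_m)^n ⋊ S_n`, where `S_n` permutes the `n` factors. -/
abbrev Wreath (m n : ℕ) : Type :=
  (Fin n → Equiv.Perm (Fin m)) ⋊[mulAutArrow] Equiv.Perm (Fin n)

/-- The group `𝕊_ν = ∏ i, S_i ≀ S_{ν i}` (the factors with `ν i = 0` are trivial). -/
abbrev SGroup (ν : GenPartition) : Type := ∀ i : ℕ, Wreath i (ν i)

/-- `𝕊^{[2]}`-modules over `ℚ`. -/
abbrev S2Mod : Type 1 := RepFamily SGroup

/-! ### The representation `⨂ i, W_i^{⊗ ν i}` of `𝕊_ν` -/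

/-- The index set of the tensor factors of `⨂ i, W_i^{⊗ ν i}`. -/
abbrev Idx (ν : GenPartition) : Type := Σ i : ℕ, Fin (ν i)

instance (ν : GenPartition) : Finite (Idx ν) := by
  have h : Function.Injective
      (fun x : Idx ν => (⟨⟨x.1, by
        rw [Finsupp.mem_support_iff]
        exact (x.2.pos).ne'⟩, x.2⟩ : Σ i : ν.support, Fin (ν i))) := by
    rintro ⟨i, a⟩ ⟨j, b⟩ hab
    simp only [Sigma.mk.injEq, Subtype.mk.injEq] at hab
    obtain ⟨rfl, hab⟩ := hab
    simpa using hab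
  exact Finite.of_injective _ h

/-- The vector space `⨂ i, W_i^{⊗ ν i}`, as one tensor product over all pairs `(i, j)` with
`j < ν i`. -/
abbrev TensorSpace (W : SMod) (ν : GenPartition) : Type :=
  ⨂[ℚ] x : Idx ν, W.carrier x.1

theorem update_act (W : SMod) (ν : GenPartition) (g : SGroup ν) [DecidableEq (Idx ν)]
    (w : ∀ x : Idx ν, W.carrier x.1) (i : ℕ) (j : Fin (ν i)) (c : W.carrier i) :
    (fun x : Idx ν => W.ρ x.1 ((g x.1).left x.2)
      (Function.update w ⟨i, j⟩ c ⟨x.1, (g x.1).right⁻¹ x.2⟩)) =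
    Function.update (fun x : Idx ν => W.ρ x.1 ((g x.1).left x.2)
      (w ⟨x.1, (g x.1).right⁻¹ x.2⟩)) ⟨i, (g i).right j⟩
      (W.ρ i ((g i).left ((g i).right j)) c) := by
  funext x
  obtain ⟨i', j'⟩ := x
  by_cases h : (⟨i', j'⟩ : Idx ν) = ⟨i, (g i).right j⟩
  · obtain ⟨rfl, h⟩ := Sigma.mk.inj_iff.1 h
    obtain rfl := eq_of_heq h
    have h2 : (⟨i', (g i').right⁻¹ ((g i').right j)⟩ : Idx ν) = ⟨i', j⟩ := by simp
    rw [Function.update_self]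
    congr 1
    have : ∀ k : Fin (ν i'), k = j → Function.update w ⟨i', j⟩ c ⟨i', k⟩ = c := by
      rintro k rfl
      exact Function.update_self ..
    exact this _ (by simp)
  · rw [Function.update_of_ne h, Function.update_of_ne]
    intro h'
    obtain ⟨rfl, h'⟩ := Sigma.mk.inj_iff.1 h'
    obtain rfl := eq_of_heq h'
    exact h (by simp)

/-- The multilinear map `(w_{i,j}) ↦ ⨂_{i,j} g_i(j) • w_{i, σ_i⁻¹ j}` for an element
`(g_i ; σ_i)_i` of `𝕊_ν`. -/
def actMultilinear (W : SMod) (ν : GenPartition) (g : SGroup ν) :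
    MultilinearMap ℚ (fun x : Idx ν => W.carrier x.1) (TensorSpace W ν) where
  toFun w := PiTensorProduct.tprod ℚ fun x : Idx ν =>
    W.ρ x.1 ((g x.1).left x.2) (w ⟨x.1, (g x.1).right⁻¹ x.2⟩)
  map_update_add' w x a b := by
    obtain ⟨i, j⟩ := x
    have key : ∀ c : W.carrier i,
        (fun x : Idx ν => W.ρ x.1 ((g x.1).left x.2)
          (Function.update w ⟨i, j⟩ c ⟨x.1, (g x.1).right⁻¹ x.2⟩)) =
        Function.update (fun x : Idx ν => W.ρ x.1 ((g x.1).left x.2)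
          (w ⟨x.1, (g x.1).right⁻¹ x.2⟩)) ⟨i, (g i).right j⟩
          (W.ρ i ((g i).left ((g i).right j)) c) := update_act W ν g w i j
    simp only [key, map_add, MultilinearMap.map_update_add]
  map_update_smul' w x q a := by
    obtain ⟨i, j⟩ := x
    have key : ∀ c : W.carrier i,
        (fun x : Idx ν => W.ρ x.1 ((g x.1).left x.2)
          (Function.update w ⟨i, j⟩ c ⟨x.1, (g x.1).right⁻¹ x.2⟩)) =
        Function.update (fun x : Idx ν => W.ρ x.1 ((g x.1).left x.2)
          (w ⟨x.1, (g x.1).right⁻¹ x.2⟩)) ⟨i, (g i).right j⟩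
          (W.ρ i ((g i).left ((g i).right j)) c) := update_act W ν g w i j
    simp only [key, map_smul, MultilinearMap.map_update_smul]

/-- The action of `𝕊_ν` on `⨂ i, W_i^{⊗ ν i}`: the `j`-th copy of `S_i` acts on the `j`-th tensor
factor `W_i`, and `S_{ν i}` permutes the `ν i` factors `W_i`. -/
def tensorRep (W : SMod) (ν : GenPartition) : Representation ℚ (SGroup ν) (TensorSpace W ν) where
  toFun g := PiTensorProduct.lift (actMultilinear W ν g)
  map_one' := by
    refine PiTensorProduct.ext (MultilinearMap.ext fun w => ?_)
    simp [actMultilinear]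
    rfl
  map_mul' g h := by
    refine PiTensorProduct.ext (MultilinearMap.ext fun w => ?_)
    simp [actMultilinear]
    rfl

/-- The equivariant map `⨂ i, U_i^{⊗ ν i} → ⨂ i, W_i^{⊗ ν i}` induced by a morphism `U ⟶ W`. -/
def tensorMap {U W : SMod} (f : U ⟶ W) (ν : GenPartition) :
    (tensorRep U ν).IntertwiningMap (tensorRep W ν) where
  toLinearMap := PiTensorProduct.map fun x : Idx ν => (RepFamily.component f x.1).toLinearMap
  isIntertwining' g := by
    refine PiTensorProduct.ext (MultilinearMap.ext fun w => ?_)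
    simp [tensorRep, actMultilinear, Representation.IntertwiningMap.isIntertwining]

/-! ### The functor `F_V` -/

/-- The vector space `F_V(W) = ⨁ ν, Hom_{𝕊_ν}(V_ν, ⨂ i, W_i^{⊗ ν i})`. -/
abbrev FObj (V : S2Mod) (W : SMod) : Type :=
  ⨁ ν : GenPartition, (V.ρ ν).IntertwiningMap (tensorRep W ν)

instance (V : S2Mod) (W : SMod) : Module.Finite ℚ (FObj V W) := by
  have hinj : ∀ ν, Function.Injective (fun φ : (V.ρ ν).IntertwiningMap (tensorRep W ν) =>
      φ.toLinearMap) := fun ν => Representation.IntertwiningMap.toLinearMap_injective _ _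
  have hfin : ∀ ν, Module.Finite ℚ ((V.ρ ν).IntertwiningMap (tensorRep W ν)) := fun ν =>
    Module.Finite.of_injective
      ({ toFun := fun φ => φ.toLinearMap
         map_add' := fun _ _ => rfl
         map_smul' := fun _ _ => rfl } :
        (V.ρ ν).IntertwiningMap (tensorRep W ν) →ₗ[ℚ] (V.carrier ν →ₗ[ℚ] TensorSpace W ν))
      (hinj ν)
  have : Finite {ν | Nontrivial (V.carrier ν)} := V.finite_support
  refine Module.Finite.of_injective
    ({ toFun := fun x ν => x ν.1
       map_add' := fun _ _ => rfl
       map_smul' := fun _ _ => rfl } :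
      FObj V W →ₗ[ℚ] (∀ ν : {ν | Nontrivial (V.carrier ν)},
        (V.ρ ν.1).IntertwiningMap (tensorRep W ν.1))) ?_
  intro x y hxy
  refine DFinsupp.ext fun ν => ?_
  by_cases h : Nontrivial (V.carrier ν)
  · exact congrFun hxy ⟨ν, h⟩
  · have := not_nontrivial_iff_subsingleton.1 h
    refine hinj ν (LinearMap.ext fun v => ?_)
    rw [Subsingleton.elim v 0, map_zero, map_zero]

/-- Functoriality of `F_V(W)` in both variables: `φ ↦ (⨂ f) ∘ φ ∘ a` on each summand. -/
def FMap {V V' : S2Mod} {W W' : SMod} (a : V' ⟶ V) (f : W ⟶ W') : FObj V W →ₗ[ℚ] FObj V' W' :=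
  DirectSum.lmap fun ν =>
    { toFun := fun φ => ((tensorMap f ν).comp φ).comp (RepFamily.component a ν)
      map_add' := fun φ ψ => by
        ext v
        exact map_add (tensorMap f ν).toLinearMap _ _
      map_smul' := fun q φ => by
        ext v
        exact map_smul (tensorMap f ν).toLinearMap _ _ }

theorem tensorMap_id (W : SMod) (ν : GenPartition) :
    tensorMap (𝟙 W) ν = Representation.IntertwiningMap.id _ := by
  refine Representation.IntertwiningMap.ext ?_
  exact PiTensorProduct.map_id

theorem tensorMap_comp {U W X : SMod} (f : U ⟶ W) (g : W ⟶ X) (ν : GenPartition) :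
    tensorMap (f ≫ g) ν = (tensorMap g ν).comp (tensorMap f ν) := by
  refine Representation.IntertwiningMap.ext ?_
  exact PiTensorProduct.map_comp _ _

theorem FMap_id (V : S2Mod) (W : SMod) : FMap (𝟙 V) (𝟙 W) = LinearMap.id := by
  refine LinearMap.ext fun x => DFinsupp.ext fun ν => ?_
  refine Representation.IntertwiningMap.ext (LinearMap.ext fun v => ?_)
  change (tensorMap (𝟙 W) ν) ((x ν) v) = x ν v
  rw [tensorMap_id]
  rfl

theorem FMap_comp {V V' V'' : S2Mod} {W W' W'' : SMod} (a : V' ⟶ V) (b : V'' ⟶ V')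
    (f : W ⟶ W') (g : W' ⟶ W'') :
    FMap (b ≫ a) (f ≫ g) = FMap b g ∘ₗ FMap a f := by
  refine LinearMap.ext fun x => DFinsupp.ext fun ν => ?_
  refine Representation.IntertwiningMap.ext (LinearMap.ext fun v => ?_)
  change (tensorMap (f ≫ g) ν) ((x ν) _) = _
  rw [tensorMap_comp]
  rfl

/-- `FMap` as a morphism of finite-dimensional vector spaces. -/
def FHom {V V' : S2Mod} {W W' : SMod} (a : V' ⟶ V) (f : W ⟶ W') :
    FGModuleCat.of ℚ (FObj V W) ⟶ FGModuleCat.of ℚ (FObj V' W') :=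
  FGModuleCat.ofHom (FMap a f)

theorem FHom_id (V : S2Mod) (W : SMod) : FHom (𝟙 V) (𝟙 W) = 𝟙 _ := by
  rw [FHom, FMap_id]
  rfl

theorem FHom_comp {V V' V'' : S2Mod} {W W' W'' : SMod} (a : V' ⟶ V) (b : V'' ⟶ V')
    (f : W ⟶ W') (g : W' ⟶ W'') :
    FHom (b ≫ a) (f ≫ g) = FHom a f ≫ FHom b g := by
  rw [FHom, FMap_comp]
  rfl

/-- The functor `F_V : 𝕊-modules ⥤ Vect`. -/
def FFunctor (V : S2Mod) : SMod ⥤ FGModuleCat.{0} ℚ where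
  obj W := FGModuleCat.of ℚ (FObj V W)
  map f := FHom (𝟙 V) f
  map_id W := FHom_id V W
  map_comp f g := by rw [← FHom_comp, Category.comp_id]

/-- The assignment `V ↦ F_V`. Since `V_ν` stands in the first argument of `Hom`, it is contravariant
in `V`. -/
def schurWeylFunctor : S2Modᵒᵖ ⥤ (SMod ⥤ FGModuleCat.{0} ℚ) where
  obj V := FFunctor V.unop
  map a :=
    { app := fun W => FHom a.unop (𝟙 W)
      naturality := fun W W' f => by
        change FHom (𝟙 _) f ≫ FHom a.unop (𝟙 W') = FHom a.unop (𝟙 W) ≫ FHom (𝟙 _) f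
        rw [← FHom_comp, ← FHom_comp, Category.comp_id, Category.comp_id,
          Category.id_comp, Category.id_comp] }
  map_id V := NatTrans.ext (funext fun W => FHom_id V.unop W)
  map_comp a b := NatTrans.ext (funext fun W => by
    change FHom (b.unop ≫ a.unop) (𝟙 W) = FHom a.unop (𝟙 W) ≫ FHom b.unop (𝟙 W)
    rw [← FHom_comp, Category.comp_id])

/-! ### Polynomial functors -/

/-- A map `φ : E → E'` of finite-dimensional vector spaces is polynomial of degree at most `d`:
for all `x₁, …, x_r` in `E`, `φ (t₁ x₁ + ⋯ + t_r x_r)` is a polynomial of total degree at most `d`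
in `t₁, …, t_r` with coefficients in `E'`. -/
def IsPolynomialMapOfDegreeLE {E E' : Type*} [AddCommGroup E] [Module ℚ E]
    [AddCommGroup E'] [Module ℚ E'] (d : ℕ) (φ : E → E') : Prop :=
  ∀ (r : ℕ) (x : Fin r → E), ∃ c : (Fin r →₀ ℕ) →₀ E',
    (∀ m ∈ c.support, m.degree ≤ d) ∧
    ∀ t : Fin r → ℚ, φ (∑ i, t i • x i) = c.sum fun m e => (∏ i, t i ^ m i) • e

/-- Polynomial mappings of finite-dimensional vector spaces. -/
def IsPolynomialMap {E E' : Type*} [AddCommGroup E] [Module ℚ E]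
    [AddCommGroup E'] [Module ℚ E'] (φ : E → E') : Prop :=
  ∃ d : ℕ, IsPolynomialMapOfDegreeLE d φ

/-- A functor `F` from `𝕊`-modules to finite-dimensional vector spaces is polynomial if every map
`Hom(U, W) → Hom(F U, F W)` is a polynomial mapping. -/
def IsPolynomialFunctor (F : SMod ⥤ FGModuleCat.{0} ℚ) : Prop :=
  ∀ U W : SMod, IsPolynomialMap (fun f : U ⟶ W => F.map f)

/-- `F` is bounded if there is one `N` such that all the maps `Hom(U, W) → Hom(F U, F W)` are
polynomial of degree at most `N` and depend only on the components `f_0, …, f_N` of a morphism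
`f = (f_n)`. -/
def IsBoundedFunctor (F : SMod ⥤ FGModuleCat.{0} ℚ) : Prop :=
  ∃ N : ℕ, ∀ U W : SMod,
    IsPolynomialMapOfDegreeLE N (fun f : U ⟶ W => F.map f) ∧
    ∀ f g : U ⟶ W, (∀ n ≤ N, RepFamily.component f n = RepFamily.component g n) →
      F.map f = F.map g

/-- The bounded polynomial functors. -/
def boundedPolynomial : ObjectProperty (SMod ⥤ FGModuleCat.{0} ℚ) :=
  fun F => IsPolynomialFunctor F ∧ IsBoundedFunctor F

/-- The category of (bounded) polynomial functors from `𝕊`-modules to finite-dimensional vector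
spaces, with natural transformations as morphisms. -/
abbrev PolyFun : Type 1 := boundedPolynomial.FullSubcategory

end SchurWeyl

end

noncomputable section

namespace SchurWeyl

/-! ### Extraction of multilinear coefficients -/

theorem exists_interpolationCoeff (N : ℕ) : ∃ l : Fin (N + 2) → ℚ,
    ∀ k ≤ N + 1, ∑ j, l j * ((j : ℕ) : ℚ) ^ k = if k = 1 then 1 else 0 := by
  have hinj : Set.InjOn (fun j : Fin (N + 2) => ((j : ℕ) : ℚ)) (Finset.univ : Finset (Fin (N + 2))) :=
    fun a _ b _ h => Fin.ext (Nat.cast_injective (R := ℚ) h)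
  refine ⟨fun j => (Lagrange.basis Finset.univ (fun j : Fin (N + 2) => ((j : ℕ) : ℚ)) j).coeff 1,
    fun k hk => ?_⟩
  have h := Lagrange.eq_interpolate (s := Finset.univ) (f := (Polynomial.X ^ k : Polynomial ℚ)) hinj
    (by
      rw [Polynomial.degree_X_pow, Finset.card_univ, Fintype.card_fin]
      exact_mod_cast Nat.lt_succ_of_le hk)
  have h1 := congrArg (fun p => Polynomial.coeff p 1) h
  simp only [Lagrange.interpolate_apply, Polynomial.finsetSum_coeff, Polynomial.coeff_C_mul,
    Polynomial.eval_pow, Polynomial.eval_X, Polynomial.coeff_X_pow] at h1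
  rw [Finset.sum_congr rfl fun j _ => mul_comm _ _, ← h1]
  simp [eq_comm]

/-- Weights `l j` with `∑ j, l j * p j = p.coeff 1` for polynomials `p` of degree at most
`N + 1`. -/
def interpolationCoeff (N : ℕ) : Fin (N + 2) → ℚ := (exists_interpolationCoeff N).choose

theorem sum_interpolationCoeff {N k : ℕ} (hk : k ≤ N + 1) :
    ∑ j, interpolationCoeff N j * ((j : ℕ) : ℚ) ^ k = if k = 1 then 1 else 0 :=
  (exists_interpolationCoeff N).choose_spec k hk

section multilinearPart

variable {X Y E E' : Type*} [Fintype X] [Fintype Y] [AddCommGroup E] [Module ℚ E]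
  [AddCommGroup E'] [Module ℚ E']

open scoped Classical in
/-- The coefficient of `∏ x, t x` in a polynomial function of degree at most `N` in the
variables `t x`. -/
def multilinearPart (N : ℕ) (g : (X → ℚ) → E) : E :=
  ∑ t : X → Fin (N + 2), (∏ x, interpolationCoeff N (t x)) • g fun x => ((t x : ℕ) : ℚ)

theorem map_multilinearPart (N : ℕ) (L : E →ₗ[ℚ] E') (g : (X → ℚ) → E) :
    L (multilinearPart N g) = multilinearPart N fun t => L (g t) := by
  simp [multilinearPart]

theorem multilinearPart_sum {ι : Type*} (N : ℕ) (s : Finset ι) (g : ι → (X → ℚ) → E) :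
    multilinearPart N (fun t => ∑ i ∈ s, g i t) = ∑ i ∈ s, multilinearPart N (g i) := by
  simp only [multilinearPart, Finset.smul_sum]
  rw [Finset.sum_comm]

theorem multilinearPart_smul (N : ℕ) (f : (X → ℚ) → ℚ) (e : E) :
    multilinearPart N (fun t => f t • e) = multilinearPart N f • e := by
  simp only [multilinearPart, Finset.sum_smul, smul_smul, smul_eq_mul]

theorem multilinearPart_prod (N : ℕ) (f : X → ℚ → ℚ) :
    multilinearPart N (fun t : X → ℚ => ∏ x, f x (t x)) =
      ∏ x, ∑ j, interpolationCoeff N j * f x ((j : ℕ) : ℚ) := by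
  classical
  simp only [multilinearPart, smul_eq_mul, ← Finset.prod_mul_distrib]
  rw [Fintype.prod_sum]

theorem multilinearPart_monomial {N : ℕ} {m : X → ℕ} (hm : ∀ x, m x ≤ N + 1) :
    multilinearPart N (fun t : X → ℚ => ∏ x, t x ^ m x) = if m = 1 then 1 else 0 := by
  rw [multilinearPart_prod N fun x s => s ^ m x]
  simp only [sum_interpolationCoeff (hm _), Finset.prod_ite_zero, Finset.prod_const_one]
  simp [funext_iff]

theorem multilinearPart_reindex (N : ℕ) (e : X ≃ Y) (g : (X → ℚ) → E) :
    multilinearPart N g = multilinearPart N fun t : Y → ℚ => g fun x => t (e x) := by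
  classical
  unfold multilinearPart
  refine Fintype.sum_equiv (e.arrowCongr (Equiv.refl (Fin (N + 2)))) _ _ fun t => ?_
  congr 1
  · exact Fintype.prod_equiv e _ _ fun x => by simp
  · simp

theorem multilinearPart_sum_pow [DecidableEq X] {N b : ℕ} (hb : b ≤ N) :
    ∃ q : ℚ, 0 < q ∧ multilinearPart N (fun t : X → ℚ => (∑ x, t x) ^ b) =
      if b = Fintype.card X then q else 0 := by
  refine ⟨Nat.multinomial (Finset.univ : Finset X) 1, by exact_mod_cast Nat.multinomial_pos _ _, ?_⟩
  simp only [Finset.sum_pow_eq_sum_piAntidiag]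
  rw [multilinearPart_sum]
  have h : ∀ k ∈ Finset.piAntidiag (Finset.univ : Finset X) b, multilinearPart N
      (fun t : X → ℚ => (Nat.multinomial Finset.univ k : ℚ) * ∏ x, t x ^ k x) =
      if k = 1 then (Nat.multinomial (Finset.univ : Finset X) 1 : ℚ) else 0 := by
    intro k hk
    rw [Finset.mem_piAntidiag] at hk
    have hkx : ∀ x, k x ≤ N + 1 := fun x =>
      (Finset.single_le_sum (fun _ _ => Nat.zero_le _) (Finset.mem_univ x)).trans
        (hk.1.le.trans (hb.trans (Nat.le_succ N)))
    have := map_multilinearPart N (LinearMap.mulLeft ℚ (Nat.multinomial Finset.univ k : ℚ))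
      (fun t : X → ℚ => ∏ x, t x ^ k x)
    simp only [LinearMap.mulLeft_apply] at this
    rw [← this, multilinearPart_monomial hkx]
    split_ifs with h1
    · rw [h1, mul_one]
    · rw [mul_zero]
  rw [Finset.sum_congr rfl h, Finset.sum_ite_eq']
  congr 1
  simp [Finset.mem_piAntidiag, eq_comm]

theorem multilinearPart_sigma_prod {Z : X → Type*} [∀ x, Fintype (Z x)] (N : ℕ)
    (f : ∀ x, (Z x → ℚ) → ℚ) :
    multilinearPart N (fun t : (Σ x, Z x) → ℚ => ∏ x, f x fun z => t ⟨x, z⟩) =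
      ∏ x, multilinearPart N (f x) := by
  classical
  simp only [multilinearPart, smul_eq_mul]
  rw [Fintype.prod_sum]
  refine Finset.sum_equiv (Equiv.piCurry fun _ _ => Fin (N + 2)) (by simp) fun t _ => ?_
  rw [Fintype.prod_sigma, ← Finset.prod_mul_distrib]
  rfl

end multilinearPart

/-! ### Polynomial maps -/

namespace IsPolynomialMapOfDegreeLE

variable {E E' E'' : Type*} [AddCommGroup E] [Module ℚ E] [AddCommGroup E'] [Module ℚ E']
  [AddCommGroup E''] [Module ℚ E''] {d : ℕ} {φ : E → E'}

theorem exists_expansion (h : IsPolynomialMapOfDegreeLE d φ) {X : Type*} [Fintype X] (x : X → E) :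
    ∃ (S : Finset (X → ℕ)) (c : (X → ℕ) → E'), (∀ m ∈ S, ∑ y, m y ≤ d) ∧
      ∀ t : X → ℚ, φ (∑ y, t y • x y) = ∑ m ∈ S, (∏ y, t y ^ m y) • c m := by
  classical
  let e := Fintype.equivFin X
  obtain ⟨c, hc, hφ⟩ := h (Fintype.card X) (x ∘ e.symm)
  have hinj : Function.Injective fun (m : Fin (Fintype.card X) →₀ ℕ) (y : X) => m (e y) :=
    fun m m' hm => Finsupp.ext fun i => by simpa using congrFun hm (e.symm i)
  refine ⟨c.support.image fun m y => m (e y),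
    fun m => c (Finsupp.equivFunOnFinite.symm (m ∘ e.symm)), ?_, fun t => ?_⟩
  · intro m hm
    obtain ⟨m, hm', rfl⟩ := Finset.mem_image.1 hm
    have := hc m hm'
    rw [Finsupp.degree_eq_sum] at this
    rwa [Equiv.sum_comp e fun i => m i]
  · rw [Finset.sum_image hinj.injOn]
    have h1 : ∑ y, t y • x y = ∑ i, (t ∘ e.symm) i • (x ∘ e.symm) i :=
      (Equiv.sum_comp e.symm fun y => t y • x y).symm
    rw [h1, hφ]
    refine Finset.sum_congr rfl fun m _ => ?_
    have h2 : Finsupp.equivFunOnFinite.symm ((fun y => m (e y)) ∘ e.symm) = m := by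
      ext i
      simp
    dsimp only
    rw [h2, ← Equiv.prod_comp e]
    simp

theorem of_expansion (h : ∀ (r : ℕ) (x : Fin r → E), ∃ (S : Finset (Fin r →₀ ℕ))
    (c : (Fin r →₀ ℕ) → E'), (∀ m ∈ S, m.degree ≤ d) ∧
      ∀ t : Fin r → ℚ, φ (∑ i, t i • x i) = ∑ m ∈ S, (∏ i, t i ^ m i) • c m) :
    IsPolynomialMapOfDegreeLE d φ := by
  classical
  intro r x
  obtain ⟨S, c, hS, hφ⟩ := h r x
  refine ⟨Finsupp.onFinset S (fun m => if m ∈ S then c m else 0)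
    fun m hm => by by_contra h; simp [h] at hm, ?_, fun t => ?_⟩
  · intro m hm
    exact hS m (Finsupp.support_onFinset_subset hm)
  · rw [hφ, Finsupp.onFinset_sum]
    · refine Finset.sum_congr rfl fun m hm => ?_
      rw [if_pos hm]
    · simp

theorem mono {d' : ℕ} (h : IsPolynomialMapOfDegreeLE d φ) (hd : d ≤ d') :
    IsPolynomialMapOfDegreeLE d' φ := fun r x =>
  let ⟨c, hc, hφ⟩ := h r x
  ⟨c, fun m hm => (hc m hm).trans hd, hφ⟩

theorem linearMap_comp (h : IsPolynomialMapOfDegreeLE d φ) (L : E' →ₗ[ℚ] E'') :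
    IsPolynomialMapOfDegreeLE d fun x => L (φ x) := by
  refine of_expansion fun r x => ?_
  obtain ⟨c, hc, hφ⟩ := h r x
  refine ⟨c.support, fun m => L (c m), hc, fun t => ?_⟩
  rw [hφ, Finsupp.sum, map_sum]
  simp

theorem of_injective (L : E' →ₗ[ℚ] E'') (hL : Function.Injective L)
    (h : IsPolynomialMapOfDegreeLE d fun x => L (φ x)) : IsPolynomialMapOfDegreeLE d φ := by
  obtain ⟨R, hR⟩ := L.exists_leftInverse_of_injective (LinearMap.ker_eq_bot.2 hL)
  convert h.linearMap_comp R using 2 with x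
  exact (LinearMap.congr_fun hR (φ x)).symm

theorem pi {ι : Type*} {A : ι → Type*} [∀ i, AddCommGroup (A i)] [∀ i, Module ℚ (A i)]
    {φ : E → ∀ i, A i} (h : ∀ i, IsPolynomialMapOfDegreeLE d fun x => φ x i) :
    IsPolynomialMapOfDegreeLE d φ := by
  classical
  refine of_expansion fun r x => ?_
  choose c hc hφ using fun i => h i r x
  have hfin : {m : Fin r →₀ ℕ | m.degree ≤ d}.Finite := Finsupp.finite_of_degree_le d
  refine ⟨hfin.toFinset, fun m i => c i m, fun m hm => by simpa using hm, fun t => ?_⟩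
  funext i
  refine (hφ i t).trans ?_
  rw [Finset.sum_apply]
  refine Finset.sum_subset_zero_on_sdiff (fun m hm => by simpa using hc i m hm) ?_ ?_
  · intro m hm
    have : c i m = 0 := by simpa using (Finset.mem_sdiff.1 hm).2
    simp [this]
  · intro m _
    simp

theorem const (e : E') : IsPolynomialMapOfDegreeLE d fun _ : E => e :=
  of_expansion fun r x => ⟨{0}, fun _ => e, by simp, by simp⟩

theorem multilinearMap {Y : Type*} [Fintype Y] {A : Y → Type*} [∀ y, AddCommGroup (A y)]
    [∀ y, Module ℚ (A y)] (f : MultilinearMap ℚ A E') (L : ∀ y, E →ₗ[ℚ] A y) :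
    IsPolynomialMapOfDegreeLE (Fintype.card Y) fun x => f fun y => L y x := by
  classical
  intro r x
  refine ⟨∑ s : Y → Fin r, Finsupp.single (∑ y, Finsupp.single (s y) 1) (f fun y => L y (x (s y))),
    ?_, fun t => ?_⟩
  · intro m hm
    obtain ⟨s, -, hs⟩ := Finset.mem_biUnion.1 (Finsupp.support_finsetSum hm)
    rw [Finset.mem_singleton.1 (Finsupp.support_single_subset hs), map_sum]
    simp
  · rw [← Finsupp.sum_finsetSum_index (by simp) (by simp [smul_add])]
    simp only [map_sum, map_smul]
    rw [f.map_sum]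
    refine Finset.sum_congr rfl fun s _ => ?_
    rw [Finsupp.sum_single_index (by simp), f.map_smul_univ fun y => t (s y)]
    congr 1
    simp only [Finsupp.coe_finsetSum, Finset.sum_apply, ← Finset.prod_pow_eq_pow_sum]
    rw [Finset.prod_comm]
    refine Finset.prod_congr rfl fun y _ => ?_
    rw [Finset.prod_eq_single (s y)] <;> simp +contextual

/-- A polynomial map which is homogeneous of degree one along three affine lines is additive. -/
theorem map_add_of_homogeneous (h : IsPolynomialMapOfDegreeLE d φ) (x a b : E)
    (ha : ∀ q : ℚ, φ (x + q • a) = q • φ (x + a)) (hb : ∀ q : ℚ, φ (x + q • b) = q • φ (x + b))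
    (hab : ∀ q : ℚ, φ (x + q • (a + b)) = q • φ (x + (a + b))) :
    φ (x + (a + b)) = φ (x + a) + φ (x + b) := by
  obtain ⟨S, c, hS, hφ⟩ := h.exists_expansion ![x, a, b]
  have key : ∀ (t : ℚ → Fin 3 → ℚ) (y : E),
      (∀ q, ∑ i, t q i • ![x, a, b] i = x + q • y) → (∀ q : ℚ, φ (x + q • y) = q • φ (x + y)) →
      φ (x + y) = ∑ m ∈ S, (∑ j : Fin (d + 2),
        interpolationCoeff d j * ∏ i, t ((j : ℕ) : ℚ) i ^ m i) • c m := by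
    intro t y ht hy
    have h1 := sum_interpolationCoeff (N := d) (k := 1) (by omega)
    simp only [pow_one, if_true] at h1
    calc φ (x + y) = (∑ j, interpolationCoeff d j * ((j : ℕ) : ℚ)) • φ (x + y) := by
          rw [h1, one_smul]
      _ = ∑ j, interpolationCoeff d j • φ (x + ((j : ℕ) : ℚ) • y) := by
          simp only [hy ((_ : ℕ) : ℚ), Finset.sum_smul, smul_smul]
      _ = _ := by
          simp only [← ht, hφ, Finset.smul_sum, Finset.sum_smul, smul_smul]
          rw [Finset.sum_comm]
  rw [key (fun q => ![1, q, q]) (a + b) (by intro q; simp [Fin.sum_univ_three, add_assoc]) hab,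
    key (fun q => ![1, q, 0]) a (by intro q; simp [Fin.sum_univ_three]) ha,
    key (fun q => ![1, 0, q]) b (by intro q; simp [Fin.sum_univ_three]) hb,
    ← Finset.sum_add_distrib]
  refine Finset.sum_congr rfl fun m hm => ?_
  rw [← add_smul]
  congr 1
  have hm' := hS m hm
  rw [Fin.sum_univ_three] at hm'
  have e1 : m 1 ≤ d + 1 := by omega
  have e2 : m 2 ≤ d + 1 := by omega
  have e3 : m 1 + m 2 ≤ d + 1 := by omega
  simp only [Fin.prod_univ_three, Matrix.cons_val_zero, Matrix.cons_val_one, Matrix.cons_val,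
    one_pow, one_mul, ← pow_add, sum_interpolationCoeff e3]
  rw [Finset.sum_congr rfl fun (j : Fin (d + 2)) _ => (mul_assoc (interpolationCoeff d j) _ _).symm,
    ← Finset.sum_mul, sum_interpolationCoeff e1]
  rw [Finset.sum_congr rfl fun (j : Fin (d + 2)) _ =>
      (mul_left_comm (interpolationCoeff d j) (0 ^ m 1) _),
    ← Finset.mul_sum, sum_interpolationCoeff e2]
  rcases Nat.eq_zero_or_pos (m 1) with h1 | h1 <;> rcases Nat.eq_zero_or_pos (m 2) with h2 | h2
  · simp [h1, h2]
  · simp [h1, h2.ne']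
  · simp [h2, h1.ne']
  · have : m 1 + m 2 ≠ 1 := by omega
    simp [this, h1.ne', h2.ne']

/-- If all polarizations of `φ` along the vectors `x k` lie in `S`, then so does `φ (∑ k, x k)`. -/
theorem sum_mem (h : IsPolynomialMapOfDegreeLE d φ) {X : Type} [Fintype X] (x : X → E)
    (S : Submodule ℚ E')
    (hS : ∀ m : X → ℕ, multilinearPart d (fun t : (Σ k, Fin (m k)) → ℚ =>
      φ (∑ y, t y • x y.1)) ∈ S) : φ (∑ k, x k) ∈ S := by
  classical
  obtain ⟨I, c, hI, hφ⟩ := h.exists_expansion x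
  have h1 : φ (∑ k, x k) = ∑ m ∈ I, c m := by simpa using hφ 1
  rw [h1]
  refine S.sum_mem fun m hm => ?_
  have hle : ∀ m' ∈ I, ∀ k, m' k ≤ d := fun m' hm' k =>
    (Finset.single_le_sum (fun _ _ => Nat.zero_le _) (Finset.mem_univ k)).trans (hI m' hm')
  choose! q hq0 hq using fun (b : ℕ) (hb : b ≤ d) (k : X) =>
    multilinearPart_sum_pow (X := Fin (m k)) hb
  have h2 : multilinearPart d (fun t : (Σ k, Fin (m k)) → ℚ => φ (∑ y, t y • x y.1)) =
      (∏ k, q (m k) k) • c m := by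
    have h3 : ∀ t : (Σ k, Fin (m k)) → ℚ, φ (∑ y, t y • x y.1) =
        ∑ m' ∈ I, (∏ k, (∑ j, t ⟨k, j⟩) ^ m' k) • c m' := by
      intro t
      rw [← hφ, Fintype.sum_sigma]
      simp only [Finset.sum_smul]
    simp only [h3]
    rw [multilinearPart_sum]
    simp only [multilinearPart_smul]
    rw [Finset.sum_eq_single m]
    · rw [multilinearPart_sigma_prod d fun k (t : Fin (m k) → ℚ) => (∑ j, t j) ^ m k]
      congr 1
      refine Finset.prod_congr rfl fun k _ => ?_
      rw [hq _ (hle m hm k) k, if_pos (by simp)]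
    · intro m' hm' hne
      obtain ⟨k, hk⟩ := Function.ne_iff.1 hne
      rw [multilinearPart_sigma_prod d fun k (t : Fin (m k) → ℚ) => (∑ j, t j) ^ m' k,
        Finset.prod_eq_zero (Finset.mem_univ k), zero_smul]
      rw [hq _ (hle m' hm' k) k, if_neg (by simpa using hk)]
    · exact fun h => absurd hm h
  have h4 := hS m
  rw [h2] at h4
  exact (S.smul_mem_iff (Finset.prod_pos fun k _ => hq0 _ (hle m hm k) k).ne').1 h4

end IsPolynomialMapOfDegreeLE

/-! ### Free `𝕊`-modules -/

instance (ν : GenPartition) : Fintype (Idx ν) := Fintype.ofFinite _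

namespace RepFamily

variable {ι : Type} {G : ι → Type} [∀ i, Group (G i)] {U V W : RepFamily G}

theorem hom_ext {f g : U ⟶ V} (h : ∀ i (u : U.carrier i), component f i u = component g i u) :
    f = g :=
  funext fun i => Representation.IntertwiningMap.ext (LinearMap.ext (h i))

/-- A component of a morphism, as a linear map in the morphism. -/
def componentₗ (U V : RepFamily G) (i : ι) :
    (U ⟶ V) →ₗ[ℚ] (U.carrier i →ₗ[ℚ] V.carrier i) where
  toFun f := (component f i).toLinearMap
  map_add' _ _ := rfl
  map_smul' _ _ := rfl

theorem componentₗ_apply (f : U ⟶ V) (i : ι) (u : U.carrier i) :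
    componentₗ U V i f u = component f i u := rfl

@[simp] theorem component_add (f g : U ⟶ V) (i : ι) (u : U.carrier i) :
    component (f + g) i u = component f i u + component g i u := rfl

@[simp] theorem component_smul (q : ℚ) (f : U ⟶ V) (i : ι) (u : U.carrier i) :
    component (q • f) i u = q • component f i u := rfl

theorem component_sum {X : Type*} (s : Finset X) (f : X → (U ⟶ V)) (i : ι) (u : U.carrier i) :
    component (∑ x ∈ s, f x) i u = ∑ x ∈ s, component (f x) i u := by
  simp only [← componentₗ_apply, map_sum, LinearMap.sum_apply]

@[simp] theorem component_comp (f : U ⟶ V) (g : V ⟶ W) (i : ι) (u : U.carrier i) :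
    component (f ≫ g) i u = component g i (component f i u) := rfl

@[simp] theorem component_id (i : ι) (u : U.carrier i) : component (𝟙 U) i u = u := rfl

theorem component_ρ (f : U ⟶ V) (i : ι) (g : G i) (u : U.carrier i) :
    component f i (U.ρ i g u) = V.ρ i g (component f i u) :=
  Representation.IntertwiningMap.isIntertwining _ _ (component f i) g u

end RepFamily

open RepFamily

/-- The free `𝕊`-module with `ν i` generators in each degree `i`. -/
def freeMod (ν : GenPartition) : SMod where
  carrier i := Fin (ν i) × Equiv.Perm (Fin i) → ℚ
  ρ i :=
    { toFun := fun h => LinearMap.funLeft ℚ ℚ fun p => (p.1, h⁻¹ * p.2)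
      map_one' := by ext; simp [LinearMap.funLeft]
      map_mul' := fun g h => by ext; simp [LinearMap.funLeft, mul_assoc] }
  finite_support := by
    refine ν.support.finite_toSet.subset fun i hi => ?_
    simp only [Finset.mem_coe, Finsupp.mem_support_iff]
    intro h0
    have : IsEmpty (Fin (ν i)) := by rw [h0]; infer_instance
    exact not_subsingleton_iff_nontrivial.2 hi inferInstance

/-- The generators of `freeMod ν`. -/
def gen (ν : GenPartition) (y : Idx ν) : (freeMod ν).carrier y.1 :=
  (Pi.single (y.2, 1) 1 : Fin (ν y.1) × Equiv.Perm (Fin y.1) → ℚ)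

/-- The morphism from a free `𝕊`-module with given values on the generators. -/
def freeLift {ν : GenPartition} {W : SMod} (w : ∀ y : Idx ν, W.carrier y.1) : freeMod ν ⟶ W :=
  fun i =>
  { toLinearMap := Fintype.linearCombination ℚ fun p : Fin (ν i) × Equiv.Perm (Fin i) =>
      W.ρ i p.2 (w ⟨i, p.1⟩)
    isIntertwining' := fun g => by
      refine LinearMap.ext fun f : Fin (ν i) × Equiv.Perm (Fin i) → ℚ => ?_
      change ∑ p : Fin (ν i) × Equiv.Perm (Fin i), f (p.1, g⁻¹ * p.2) • W.ρ i p.2 (w ⟨i, p.1⟩) =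
        W.ρ i g (∑ p : Fin (ν i) × Equiv.Perm (Fin i), f p • W.ρ i p.2 (w ⟨i, p.1⟩))
      rw [map_sum]
      refine Fintype.sum_equiv (Equiv.prodCongr (Equiv.refl _) (Equiv.mulLeft g⁻¹)) _ _
        fun p => ?_
      change _ = W.ρ i g (f (p.1, g⁻¹ * p.2) • W.ρ i (g⁻¹ * p.2) (w ⟨i, p.1⟩))
      rw [map_smul, ← Module.End.mul_apply, ← map_mul, mul_inv_cancel_left] }

theorem component_freeLift {ν : GenPartition} {W : SMod} (w : ∀ y : Idx ν, W.carrier y.1) (i : ℕ)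
    (f : Fin (ν i) × Equiv.Perm (Fin i) → ℚ) :
    component (freeLift w) i f =
      ∑ p : Fin (ν i) × Equiv.Perm (Fin i), f p • W.ρ i p.2 (w ⟨i, p.1⟩) := rfl

/-- `freeLift` as a linear map. -/
def hat {ν : GenPartition} {W : SMod} :
    (∀ y : Idx ν, W.carrier y.1) →ₗ[ℚ] (freeMod ν ⟶ W) where
  toFun := freeLift
  map_add' w w' := by
    refine RepFamily.hom_ext fun i f => ?_
    rw [component_add]
    refine (component_freeLift _ i f).trans (.trans ?_ (congrArg₂ (· + ·)
      (component_freeLift _ i f) (component_freeLift _ i f)).symm)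
    simp [Finset.sum_add_distrib]
  map_smul' q w := by
    refine RepFamily.hom_ext fun i f => ?_
    rw [RingHom.id_apply, component_smul]
    refine (component_freeLift _ i f).trans (.trans ?_ (congrArg (q • ·)
      (component_freeLift _ i f)).symm)
    simp [Finset.smul_sum, smul_comm q]

section free

variable {ν : GenPartition} {W W' : SMod}

theorem component_hat (w : ∀ y : Idx ν, W.carrier y.1) (i : ℕ)
    (f : Fin (ν i) × Equiv.Perm (Fin i) → ℚ) :
    component (hat w) i f =
      ∑ p : Fin (ν i) × Equiv.Perm (Fin i), f p • W.ρ i p.2 (w ⟨i, p.1⟩) := rfl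

@[simp] theorem component_hat_gen (w : ∀ y : Idx ν, W.carrier y.1) (y : Idx ν) :
    component (hat w) y.1 (gen ν y) = w y := by
  refine (component_hat w y.1 _).trans ?_
  rw [Finset.sum_eq_single (y.2, 1)]
  · simp [gen]
  · intro p _ hp
    rw [gen, Pi.single_eq_of_ne hp, zero_smul]
  · simp

theorem ρ_gen (i : ℕ) (j : Fin (ν i)) (g : Equiv.Perm (Fin i)) :
    (freeMod ν).ρ i g (gen ν ⟨i, j⟩) =
      (Pi.single (j, g) 1 : Fin (ν i) × Equiv.Perm (Fin i) → ℚ) := by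
  funext p
  change (Pi.single (j, 1) 1 : Fin (ν i) × Equiv.Perm (Fin i) → ℚ) (p.1, g⁻¹ * p.2) = _
  simp [Pi.single_apply, Prod.ext_iff, inv_mul_eq_one, eq_comm]

theorem freeMod_hom_ext {f f' : freeMod ν ⟶ W}
    (h : ∀ y : Idx ν, component f y.1 (gen ν y) = component f' y.1 (gen ν y)) : f = f' := by
  refine funext fun i => Representation.IntertwiningMap.ext ?_
  refine LinearMap.pi_ext' fun p => LinearMap.ext_ring ?_
  change component f i (Pi.single p 1 : Fin (ν i) × Equiv.Perm (Fin i) → ℚ) =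
    component f' i (Pi.single p 1 : Fin (ν i) × Equiv.Perm (Fin i) → ℚ)
  rw [← ρ_gen i p.1 p.2, component_ρ, component_ρ, h ⟨i, p.1⟩]

theorem hat_comp (w : ∀ y : Idx ν, W.carrier y.1) (f : W ⟶ W') :
    hat w ≫ f = hat fun y => component f y.1 (w y) :=
  freeMod_hom_ext fun y => by simp

theorem hat_gen : hat (gen ν) = 𝟙 (freeMod ν) :=
  freeMod_hom_ext fun y => by simp

/-- Rescaling of the generators of a free `𝕊`-module. -/
def scale (t : Idx ν → ℚ) : freeMod ν ⟶ freeMod ν := hat fun y => t y • gen ν y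

theorem scale_comp_hat (t : Idx ν → ℚ) (w : ∀ y : Idx ν, W.carrier y.1) :
    scale t ≫ hat w = hat fun y => t y • w y := by
  rw [scale, hat_comp]
  congr 1
  funext y
  rw [map_smul, component_hat_gen]

theorem component_scale (t : Idx ν → ℚ) (i : ℕ) (f : Fin (ν i) × Equiv.Perm (Fin i) → ℚ) :
    component (scale t) i f =
      (fun p => t ⟨i, p.1⟩ * f p : Fin (ν i) × Equiv.Perm (Fin i) → ℚ) := by
  refine (component_hat _ i f).trans ?_
  simp only [map_smul, ρ_gen]
  funext q
  refine (Finset.sum_apply q _ _).trans ?_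
  rw [Finset.sum_eq_single q]
  · change f q * (t ⟨i, q.1⟩ * (Pi.single (q.1, q.2) 1 :
      Fin (ν i) × Equiv.Perm (Fin i) → ℚ) q) = _
    simp [mul_comm]
  · intro p _ hp
    change f p * (t ⟨i, p.1⟩ * (Pi.single (p.1, p.2) 1 :
      Fin (ν i) × Equiv.Perm (Fin i) → ℚ) q) = _
    simp [hp.symm]
  · simp

theorem scale_comp_scale (s t : Idx ν → ℚ) :
    (scale s ≫ scale t : freeMod ν ⟶ freeMod ν) = scale (s * t) := by
  rw [show (scale t : freeMod ν ⟶ freeMod ν) = hat fun y => t y • gen ν y from rfl,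
    scale_comp_hat, scale]
  simp only [smul_smul, Pi.mul_apply]

theorem scale_eq_sum (t : Idx ν → ℚ) :
    (scale t : freeMod ν ⟶ freeMod ν) = ∑ y, t y • hat (Pi.single y (gen ν y)) := by
  rw [scale]
  simp only [← map_smul, ← map_sum, ← Pi.single_smul]
  congr 1
  exact (Finset.univ_sum_single fun y => t y • gen ν y).symm

/-- The morphism to a free `𝕊`-module defined by a family of functionals. -/
def cohat (ω : ∀ y : Idx ν, Module.Dual ℚ (W.carrier y.1)) : W ⟶ freeMod ν := fun i =>
  { toLinearMap := LinearMap.pi fun p : Fin (ν i) × Equiv.Perm (Fin i) =>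
      (ω ⟨i, p.1⟩).comp (W.ρ i p.2⁻¹)
    isIntertwining' := fun g => by
      refine LinearMap.ext fun w => funext fun p => ?_
      change ω ⟨i, p.1⟩ (W.ρ i p.2⁻¹ (W.ρ i g w)) = ω ⟨i, p.1⟩ (W.ρ i (g⁻¹ * p.2)⁻¹ w)
      simp }

/-- The endomorphism of `W`, concentrated in degree `n`, which maps `u` to
`∑ g, ω (g⁻¹ u) • g w`. -/
def averagedRankOne (d : Σ n, Module.Dual ℚ (W.carrier n) × W.carrier n) : W ⟶ W :=
  (Pi.single d.1
    { toFun := fun u => ∑ g, d.2.1 (W.ρ d.1 g⁻¹ u) • W.ρ d.1 g d.2.2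
      map_add' := fun u u' => by simp [add_smul, Finset.sum_add_distrib]
      map_smul' := fun q u => by simp [mul_smul, Finset.smul_sum]
      isIntertwining' := fun h => by
        refine LinearMap.ext fun u => ?_
        simp only [LinearMap.comp_apply, LinearMap.coe_mk, AddHom.coe_mk, map_sum, map_smul]
        refine Fintype.sum_equiv (Equiv.mulLeft h⁻¹) _ _ fun g => ?_
        simp [← Module.End.mul_apply, ← map_mul] } :
    ∀ i, (W.ρ i).IntertwiningMap (W.ρ i))

theorem component_averagedRankOne_self (n : ℕ) (ω : Module.Dual ℚ (W.carrier n))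
    (w u : W.carrier n) :
    component (averagedRankOne ⟨n, ω, w⟩) n u = ∑ g, ω (W.ρ n g⁻¹ u) • W.ρ n g w := by
  rw [component, averagedRankOne, Pi.single_eq_same]
  rfl

theorem component_averagedRankOne_of_ne
    (d : Σ n, Module.Dual ℚ (W.carrier n) × W.carrier n) {i : ℕ} (h : i ≠ d.1)
    (u : W.carrier i) : component (averagedRankOne d) i u = 0 := by
  rw [component, averagedRankOne, Pi.single_eq_of_ne h]
  rfl

theorem cohat_scale_hat (ω : ∀ y : Idx ν, Module.Dual ℚ (W.carrier y.1)) (t : Idx ν → ℚ)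
    (w : ∀ y : Idx ν, W.carrier y.1) :
    cohat ω ≫ scale t ≫ hat w = ∑ y, t y • averagedRankOne ⟨y.1, ω y, w y⟩ := by
  refine RepFamily.hom_ext fun i u => ?_
  rw [scale_comp_hat, component_sum]
  refine Eq.trans (b := ∑ j : Fin (ν i), t ⟨i, j⟩ •
    ∑ g, ω ⟨i, j⟩ (W.ρ i g⁻¹ u) • W.ρ i g (w ⟨i, j⟩)) ?_ ?_
  · rw [component_comp]
    refine (component_hat _ i _).trans ?_
    rw [Fintype.sum_prod_type]
    refine Finset.sum_congr rfl fun j _ => ?_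
    rw [Finset.smul_sum]
    refine Finset.sum_congr rfl fun g _ => ?_
    rw [map_smul, smul_comm]
    rfl
  · refine Fintype.sum_of_injective (fun j => (⟨i, j⟩ : Idx ν)) (fun j j' h => by simpa using h) _ _ ?_ ?_
    · rintro ⟨i', j⟩ hj
      rw [component_smul, component_averagedRankOne_of_ne, smul_zero]
      rintro rfl
      exact hj ⟨j, rfl⟩
    · intro j
      rw [component_smul, component_averagedRankOne_self]

theorem exists_id_eq_sum (W : SMod) : ∃ (X : Type) (_ : Fintype X)
    (d : X → Σ n, Module.Dual ℚ (W.carrier n) × W.carrier n),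
    𝟙 W = ∑ x, averagedRankOne (d x) := by
  classical
  have := W.finite_support.fintype
  let b := fun n => Module.finBasis ℚ (W.carrier n)
  refine ⟨Σ n : {i | Nontrivial (W.carrier i)}, Fin (Module.finrank ℚ (W.carrier n)),
    inferInstance, fun x => ⟨x.1, ((Fintype.card (Equiv.Perm (Fin x.1)) : ℚ)⁻¹ • (b x.1).coord x.2,
      b x.1 x.2)⟩, ?_⟩
  refine RepFamily.hom_ext fun i u => ?_
  rw [component_id, component_sum, Fintype.sum_sigma]
  by_cases hi : Nontrivial (W.carrier i)
  · rw [Finset.sum_eq_single (⟨i, hi⟩ : {i | Nontrivial (W.carrier i)})]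
    · simp only [component_averagedRankOne_self]
      rw [Finset.sum_comm]
      have h : ∀ g : Equiv.Perm (Fin i), ∑ k, ((Fintype.card (Equiv.Perm (Fin i)) : ℚ)⁻¹ •
          (b i).coord k) (W.ρ i g⁻¹ u) • W.ρ i g (b i k) =
          (Fintype.card (Equiv.Perm (Fin i)) : ℚ)⁻¹ • u := by
        intro g
        simp only [LinearMap.smul_apply, smul_assoc, ← Finset.smul_sum]
        congr 1
        simp only [← map_smul, ← map_sum, Module.Basis.coord_apply, Module.Basis.sum_repr]
        simp [← Module.End.mul_apply, ← map_mul]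
      rw [Finset.sum_congr rfl fun g _ => h g, Finset.sum_const, ← Nat.cast_smul_eq_nsmul ℚ,
        smul_smul, Finset.card_univ, mul_inv_cancel₀, one_smul]
      exact_mod_cast Fintype.card_ne_zero
    · intro n _ hn
      refine Finset.sum_eq_zero fun k _ => component_averagedRankOne_of_ne _ ?_ u
      rintro rfl
      exact hn rfl
    · simp
  · have := not_nontrivial_iff_subsingleton.1 hi
    exact Subsingleton.elim _ _

/-- A finite family of degrees is, up to reindexing, the family of parts of a generalized
partition. -/
theorem exists_equiv_idx {Y : Type} [Fintype Y] {A : ℕ → Type*} (d : Y → Σ n, A n) :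
    ∃ (ν : GenPartition) (e : Y ≃ Idx ν) (a : ∀ y : Idx ν, A y.1),
      ∀ y, d y = ⟨(e y).1, a (e y)⟩ := by
  classical
  let ν : GenPartition := Finsupp.onFinset (Finset.univ.image fun y => (d y).1)
    (fun n => Fintype.card {y // (d y).1 = n}) (by
      intro n hn
      obtain ⟨⟨y, hy⟩⟩ := Fintype.card_pos_iff.1 (Nat.pos_of_ne_zero hn)
      exact Finset.mem_image.2 ⟨y, Finset.mem_univ y, hy⟩)
  let e : Y ≃ Idx ν := (Equiv.sigmaFiberEquiv fun y => (d y).1).symm.trans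
    (Equiv.sigmaCongrRight fun n => Fintype.equivFin {y // (d y).1 = n})
  have he : ∀ y, (e y).1 = (d y).1 := fun y => rfl
  have h : ∀ (s : Σ n, A n) (n : ℕ), n = s.1 → ∃ a : A n, s = ⟨n, a⟩ := by
    rintro ⟨n, a⟩ _ rfl
    exact ⟨a, rfl⟩
  choose a ha using fun y : Idx ν => h (d (e.symm y)) y.1 (by rw [← he, e.apply_symm_apply])
  exact ⟨ν, e, a, fun y => by rw [← ha, e.symm_apply_apply]⟩

end free

/-! ### Polynomial functors are generated by their multilinear parts -/

section functor

variable (F G : SMod ⥤ FGModuleCat.{0} ℚ) {U W X : SMod}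

/-- The linear map `F f`. -/
def mapₗ (f : U ⟶ W) : F.obj U →ₗ[ℚ] F.obj W := (F.map f).hom.hom

@[simp] theorem mapₗ_id (z : F.obj U) : mapₗ F (𝟙 U) z = z := by
  simp [mapₗ]

theorem mapₗ_comp (f : U ⟶ W) (g : W ⟶ X) (z : F.obj U) :
    mapₗ F (f ≫ g) z = mapₗ F g (mapₗ F f z) := by
  simp [mapₗ]

variable {F G}

/-- The components of a natural transformation as linear maps. -/
def appₗ (α : F ⟶ G) (W : SMod) : F.obj W →ₗ[ℚ] G.obj W := (α.app W).hom.hom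

theorem appₗ_mapₗ (α : F ⟶ G) (f : U ⟶ W) (z : F.obj U) :
    appₗ α W (mapₗ F f z) = mapₗ G f (appₗ α U z) := by
  exact congrArg (fun h : F.obj U ⟶ G.obj W => h.hom.hom z) (α.naturality f)

theorem natTrans_ext {α β : F ⟶ G} (h : ∀ W z, appₗ α W z = appₗ β W z) : α = β :=
  NatTrans.ext (funext fun W => FGModuleCat.hom_ext (LinearMap.ext (h W)))

/-- All maps `Hom(U, W) → Hom(F U, F W)` are polynomial of degree at most `N`. -/
def HasDegreeLE (F : SMod ⥤ FGModuleCat.{0} ℚ) (N : ℕ) : Prop :=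
  ∀ U W : SMod, IsPolynomialMapOfDegreeLE N (fun f : U ⟶ W => F.map f)

theorem HasDegreeLE.mapₗ_apply {N : ℕ} (hF : HasDegreeLE F N) (z : F.obj U) :
    IsPolynomialMapOfDegreeLE N (fun f : U ⟶ W => mapₗ F f z) :=
  (hF U W).linearMap_comp
    { toFun := fun f => f.hom.hom z
      map_add' := fun _ _ => rfl
      map_smul' := fun _ _ => rfl }

/-- The projection of `F (freeMod ν)` onto its multilinear part. -/
def multilinearProj (F : SMod ⥤ FGModuleCat.{0} ℚ) (N : ℕ) {ν : GenPartition}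
    (z : F.obj (freeMod ν)) : F.obj (freeMod ν) :=
  multilinearPart N fun t => mapₗ F (scale t) z

theorem HasDegreeLE.mem_of_multilinearProj {N : ℕ} (hF : HasDegreeLE F N)
    (S : Submodule ℚ (F.obj W)) (z : F.obj W)
    (h : ∀ (ν : GenPartition) (w : ∀ y : Idx ν, W.carrier y.1)
      (ω : ∀ y : Idx ν, Module.Dual ℚ (W.carrier y.1)),
      mapₗ F (hat w) (multilinearProj F N (mapₗ F (cohat ω) z)) ∈ S) : z ∈ S := by
  obtain ⟨X, _, d, hd⟩ := exists_id_eq_sum W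
  have key := (hF.mapₗ_apply (W := W) z).sum_mem (fun x => averagedRankOne (d x)) S fun m => by
    obtain ⟨ν, e, a, ha⟩ := exists_equiv_idx fun y : Σ k, Fin (m k) => d y.1
    convert h ν (fun y => (a y).2) (fun y => (a y).1) using 1
    rw [multilinearProj, map_multilinearPart, multilinearPart_reindex N e.symm]
    congr 1
    funext t
    rw [← mapₗ_comp, ← mapₗ_comp, cohat_scale_hat, ← Equiv.sum_comp e]
    simp [ha]
  rwa [← hd, mapₗ_id] at key

/-- The multilinear part of `F (freeMod ν)`. -/
def multilinearSubmodule (F : SMod ⥤ FGModuleCat.{0} ℚ) (ν : GenPartition) :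
    Submodule ℚ (F.obj (freeMod ν)) where
  carrier := {m | ∀ t : Idx ν → ℚ, mapₗ F (scale t) m = (∏ y, t y) • m}
  zero_mem' := fun t => by simp
  add_mem' := fun ha hb t => by rw [map_add, ha t, hb t, smul_add]
  smul_mem' := fun q m hm t => by rw [map_smul, hm t, smul_comm]

theorem HasDegreeLE.exists_scale_expansion {N : ℕ} (hF : HasDegreeLE F N) {ν : GenPartition}
    (z : F.obj (freeMod ν)) : ∃ (S : Finset (Idx ν → ℕ)) (c : (Idx ν → ℕ) → F.obj (freeMod ν)),
      (∀ m ∈ S, ∑ y, m y ≤ N) ∧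
      ∀ t : Idx ν → ℚ, mapₗ F (scale t) z = ∑ m ∈ S, (∏ y, t y ^ m y) • c m := by
  simp only [scale_eq_sum]
  exact (hF.mapₗ_apply z).exists_expansion fun y => hat (Pi.single y (gen ν y))

theorem HasDegreeLE.multilinearProj_mem {N : ℕ} (hF : HasDegreeLE F N) {ν : GenPartition}
    (z : F.obj (freeMod ν)) : multilinearProj F N z ∈ multilinearSubmodule F ν := by
  obtain ⟨S, c, hS, hc⟩ := hF.exists_scale_expansion z
  have hle : ∀ m ∈ S, ∀ y, m y ≤ N + 1 := fun m hm y =>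
    (Finset.single_le_sum (fun _ _ => Nat.zero_le _) (Finset.mem_univ y)).trans
      ((hS m hm).trans (Nat.le_succ N))
  have key : ∀ s : Idx ν → ℚ, multilinearPart N (fun t => mapₗ F (scale (t * s)) z) =
      ∑ m ∈ S, if m = 1 then (∏ y, s y) • c m else 0 := by
    intro s
    simp only [hc, Pi.mul_apply, mul_pow, Finset.prod_mul_distrib, mul_smul]
    rw [multilinearPart_sum]
    refine Finset.sum_congr rfl fun m hm => ?_
    rw [multilinearPart_smul, multilinearPart_monomial (hle m hm)]
    split_ifs with h1
    · simp [h1]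
    · simp
  intro s
  rw [multilinearProj, map_multilinearPart]
  simp only [← mapₗ_comp, scale_comp_scale]
  rw [key s]
  have h1 := key 1
  simp only [mul_one, Pi.one_apply, Finset.prod_const_one, one_smul] at h1
  rw [h1, Finset.smul_sum]
  refine Finset.sum_congr rfl fun m _ => ?_
  split_ifs
  · rfl
  · simp

theorem multilinearProj_of_mem (N : ℕ) {ν : GenPartition} {m : F.obj (freeMod ν)}
    (hm : m ∈ multilinearSubmodule F ν) : multilinearProj F N m = m := by
  rw [multilinearProj]
  simp only [hm _]
  rw [multilinearPart_smul]
  have := multilinearPart_monomial (X := Idx ν) (N := N) (m := 1) (by simp)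
  simp only [Pi.one_apply, pow_one, if_true] at this
  rw [this, one_smul]

theorem appₗ_multilinearProj (α : F ⟶ G) (N : ℕ) {ν : GenPartition} (z : F.obj (freeMod ν)) :
    appₗ α _ (multilinearProj F N z) = multilinearProj G N (appₗ α _ z) := by
  simp only [multilinearProj, map_multilinearPart, appₗ_mapₗ]

theorem appₗ_mem_multilinearSubmodule (α : F ⟶ G) {ν : GenPartition} {z : F.obj (freeMod ν)}
    (hz : z ∈ multilinearSubmodule F ν) : appₗ α _ z ∈ multilinearSubmodule G ν := fun t => by
  rw [← appₗ_mapₗ, hz t, map_smul]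

theorem HasDegreeLE.natTrans_ext {N : ℕ} (hF : HasDegreeLE F N) {α β : F ⟶ G}
    (h : ∀ ν, ∀ z ∈ multilinearSubmodule F ν, appₗ α _ z = appₗ β _ z) : α = β := by
  refine SchurWeyl.natTrans_ext fun W z => ?_
  refine hF.mem_of_multilinearProj (LinearMap.eqLocus (appₗ α W) (appₗ β W)) z fun ν w ω => ?_
  rw [LinearMap.mem_eqLocus, appₗ_mapₗ, appₗ_mapₗ, h ν _ (hF.multilinearProj_mem _)]

theorem HasDegreeLE.appₗ_injective {N : ℕ} (hF : HasDegreeLE F N) (α : F ⟶ G)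
    (h : ∀ ν, ∀ z ∈ multilinearSubmodule F ν, appₗ α _ z = 0 → z = 0) (W : SMod) :
    Function.Injective (appₗ α W) := by
  rw [injective_iff_map_eq_zero]
  intro z hz
  refine (Submodule.mem_bot ℚ).1 (hF.mem_of_multilinearProj ⊥ z fun ν w ω => ?_)
  rw [h ν _ (hF.multilinearProj_mem _), map_zero]
  · exact Submodule.zero_mem _
  · rw [appₗ_multilinearProj, appₗ_mapₗ, hz, map_zero]
    simp [multilinearProj, multilinearPart]

theorem HasDegreeLE.appₗ_surjective {N : ℕ} (hG : HasDegreeLE G N) (α : F ⟶ G)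
    (h : ∀ ν, ∀ z ∈ multilinearSubmodule G ν, ∃ x, appₗ α _ x = z) (W : SMod) :
    Function.Surjective (appₗ α W) := by
  intro z
  refine hG.mem_of_multilinearProj (LinearMap.range (appₗ α W)) z fun ν w ω => ?_
  obtain ⟨x, hx⟩ := h ν _ (hG.multilinearProj_mem (mapₗ G (cohat ω) z))
  exact ⟨mapₗ F (hat w) x, by rw [appₗ_mapₗ, hx]⟩

theorem isIso_of_bijective (α : F ⟶ G) (h : ∀ W, Function.Bijective (appₗ α W)) : IsIso α := by
  have : ∀ W, IsIso (α.app W) := fun W => by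
    let e := LinearEquiv.ofBijective (appₗ α W) (h W)
    refine ⟨⟨FGModuleCat.ofHom e.symm.toLinearMap, ?_, ?_⟩⟩
    · refine FGModuleCat.hom_ext (LinearMap.ext fun z => e.symm_apply_apply z)
    · refine FGModuleCat.hom_ext (LinearMap.ext fun z => e.apply_symm_apply z)
  exact NatIso.isIso_of_isIso_app α

end functor

/-! ### The action of `𝕊_ν` on free `𝕊`-modules -/

instance (ν : GenPartition) : Finite (SGroup ν) := by
  have hfin : ∀ m n, Finite (Wreath m n) := fun m n =>
    Finite.of_equiv _ SemidirectProduct.equivProd.symm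
  have h : Function.Injective (fun (g : SGroup ν) (i : ν.support) => g i) := by
    intro g g' hgg
    funext i
    by_cases hi : i ∈ ν.support
    · exact congrFun hgg ⟨i, hi⟩
    · have : IsEmpty (Fin (ν i)) := by
        rw [Finsupp.notMem_support_iff.1 hi]
        infer_instance
      exact SemidirectProduct.ext (Subsingleton.elim _ _) (Subsingleton.elim _ _)
  exact Finite.of_injective _ h

instance (ν : GenPartition) : Fintype (SGroup ν) := Fintype.ofFinite _

section action

variable {ν : GenPartition} {W W' : SMod} {F : SMod ⥤ FGModuleCat.{0} ℚ}

/-- The permutation of the tensor factors underlying the inverse of an element of `𝕊_ν`. -/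
def permIdx (g : SGroup ν) : Equiv.Perm (Idx ν) := Equiv.sigmaCongrRight fun i => (g i).right⁻¹

/-- The action of `𝕊_ν` on families of elements of `W`. -/
def actTuple (g : SGroup ν) (w : ∀ y : Idx ν, W.carrier y.1) (y : Idx ν) : W.carrier y.1 :=
  W.ρ y.1 ((g y.1).left y.2) (w (permIdx g y))

theorem tensorRep_tprod (g : SGroup ν) (w : ∀ y : Idx ν, W.carrier y.1) :
    tensorRep W ν g (PiTensorProduct.tprod ℚ w) = PiTensorProduct.tprod ℚ (actTuple g w) :=
  PiTensorProduct.lift.tprod _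

theorem tensorMap_tprod (f : W ⟶ W') (w : ∀ y : Idx ν, W.carrier y.1) :
    tensorMap f ν (PiTensorProduct.tprod ℚ w) =
      PiTensorProduct.tprod ℚ fun y => component f y.1 (w y) :=
  PiTensorProduct.map_tprod _ _

theorem actTuple_one (w : ∀ y : Idx ν, W.carrier y.1) : actTuple 1 w = w := by
  funext y
  change W.ρ y.1 1 (w ⟨y.1, (1 : Equiv.Perm (Fin (ν y.1)))⁻¹ y.2⟩) = w y
  simp
  rfl

theorem actTuple_mul (g h : SGroup ν) (w : ∀ y : Idx ν, W.carrier y.1) :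
    actTuple (g * h) w = actTuple g (actTuple h w) := by
  funext y
  simp [actTuple, permIdx]
  rfl

theorem component_actTuple (f : W ⟶ W') (g : SGroup ν) (w : ∀ y : Idx ν, W.carrier y.1) :
    (fun y => component f y.1 (actTuple g w y)) = actTuple g fun y => component f y.1 (w y) :=
  funext fun y => component_ρ f y.1 _ _

/-- The automorphism of a free `𝕊`-module given by an element of `𝕊_ν`. -/
def shift (g : SGroup ν) : freeMod ν ⟶ freeMod ν := hat (actTuple g (gen ν))

theorem shift_comp_hat (g : SGroup ν) (w : ∀ y : Idx ν, W.carrier y.1) :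
    shift g ≫ hat w = hat (actTuple g w) := by
  rw [shift, hat_comp, component_actTuple]
  simp only [component_hat_gen]

theorem shift_one : shift (1 : SGroup ν) = 𝟙 _ := by
  rw [shift, actTuple_one, hat_gen]

theorem shift_mul (g h : SGroup ν) : shift (g * h) = shift g ≫ shift h := by
  rw [show shift h = hat (actTuple h (gen ν)) from rfl, shift_comp_hat, shift, actTuple_mul]

theorem shift_comp_scale (g : SGroup ν) (t : Idx ν → ℚ) :
    shift g ≫ scale t = scale (t ∘ permIdx g) ≫ shift g := by
  rw [shift, scale_comp_hat, scale, ← shift, shift_comp_hat]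
  congr 1

theorem mapₗ_shift_mem (g : SGroup ν) {m : F.obj (freeMod ν)} (hm : m ∈ multilinearSubmodule F ν) :
    mapₗ F (shift g) m ∈ multilinearSubmodule F ν := fun t => by
  rw [← mapₗ_comp, shift_comp_scale, mapₗ_comp, hm, map_smul,
    ← Equiv.prod_comp (permIdx g) t]
  rfl

/-- The right action of `𝕊_ν` on the multilinear part of `F (freeMod ν)`. -/
def shiftₗ (F : SMod ⥤ FGModuleCat.{0} ℚ) (g : SGroup ν) :
    multilinearSubmodule F ν →ₗ[ℚ] multilinearSubmodule F ν :=
  (mapₗ F (shift g)).restrict fun _ hm => mapₗ_shift_mem g hm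

/-- The dual of the multilinear part of `F (freeMod ν)` as a representation of `𝕊_ν`. -/
def dualMultilinearRep (F : SMod ⥤ FGModuleCat.{0} ℚ) (ν : GenPartition) :
    Representation ℚ (SGroup ν) (Module.Dual ℚ (multilinearSubmodule F ν)) where
  toFun g := (shiftₗ F g).dualMap
  map_one' := by
    refine LinearMap.ext fun ξ => LinearMap.ext fun m => congrArg ξ (Subtype.ext ?_)
    change mapₗ F (shift 1) (m : F.obj (freeMod ν)) = m
    rw [shift_one, mapₗ_id]
  map_mul' g h := by
    refine LinearMap.ext fun ξ => LinearMap.ext fun m => congrArg ξ (Subtype.ext ?_)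
    change mapₗ F (shift (g * h)) (m : F.obj (freeMod ν)) = mapₗ F (shift h) (mapₗ F (shift g) m)
    rw [shift_mul, mapₗ_comp]

/-- The natural map `⨂ i, W_i^{⊗ ν i} → F W` corresponding to an element of the multilinear part
of `F (freeMod ν)`. -/
def HasDegreeLE.theta {N : ℕ} (hF : HasDegreeLE F N) (m : multilinearSubmodule F ν) (W : SMod) :
    TensorSpace W ν →ₗ[ℚ] F.obj W :=
  PiTensorProduct.lift
    { toFun := fun w => mapₗ F (hat w) m
      map_update_add' := fun w y a b => by
        have h0 : ∀ c, hat (Function.update w y c) =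
            hat (Function.update w y 0) + hat (Pi.single y c) := fun c => by
          classical
          rw [← map_add]
          congr 1
          funext x
          by_cases hx : x = y
          · subst hx
            simp
          · simp [hx]
        have h1 : ∀ c (q : ℚ), hat (Function.update w y (q • c)) =
            scale (Function.update 1 y q) ≫ hat (Function.update w y c) := fun c q => by
          rw [scale_comp_hat]
          congr 1
          funext x
          by_cases hx : x = y
          · subst hx
            simp
          · simp [hx]
        have h2 : ∀ c (q : ℚ), mapₗ F (hat (Function.update w y 0) + q • hat (Pi.single y c))
            (m : F.obj (freeMod ν)) =
            q • mapₗ F (hat (Function.update w y 0) + hat (Pi.single y c))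
              (m : F.obj (freeMod ν)) :=
          fun c q => by
          classical
          rw [← map_smul, ← Pi.single_smul, ← h0, ← h0, h1, mapₗ_comp, m.2, map_smul,
            Finset.prod_update_of_mem (Finset.mem_univ y)]
          simp
        have h3 := (hF.mapₗ_apply (m : F.obj (freeMod ν))).map_add_of_homogeneous
          (hat (Function.update w y 0)) (hat (Pi.single y a)) (hat (Pi.single y b)) (h2 a) (h2 b)
          (by simpa only [← map_add, ← Pi.single_add] using h2 (a + b))
        rwa [← map_add hat (Pi.single y a), ← Pi.single_add, ← h0, ← h0, ← h0] at h3
      map_update_smul' := fun w y q c => by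
        classical
        have h1 : hat (Function.update w y (q • c)) =
            scale (Function.update 1 y q) ≫ hat (Function.update w y c) := by
          rw [scale_comp_hat]
          congr 1
          funext x
          by_cases hx : x = y
          · subst hx
            simp
          · simp [hx]
        rw [h1, mapₗ_comp, m.2, map_smul, Finset.prod_update_of_mem (Finset.mem_univ y)]
        simp }

theorem HasDegreeLE.theta_tprod {N : ℕ} (hF : HasDegreeLE F N) (m : multilinearSubmodule F ν)
    (w : ∀ y : Idx ν, W.carrier y.1) :
    hF.theta m W (PiTensorProduct.tprod ℚ w) = mapₗ F (hat w) m :=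
  PiTensorProduct.lift.tprod _

theorem HasDegreeLE.mapₗ_theta {N : ℕ} (hF : HasDegreeLE F N) (m : multilinearSubmodule F ν)
    (f : W ⟶ W') (t : TensorSpace W ν) :
    mapₗ F f (hF.theta m W t) = hF.theta m W' (tensorMap f ν t) := by
  have : mapₗ F f ∘ₗ hF.theta m W = hF.theta m W' ∘ₗ (tensorMap f ν).toLinearMap := by
    refine PiTensorProduct.ext (MultilinearMap.ext fun w => ?_)
    change mapₗ F f (hF.theta m W (PiTensorProduct.tprod ℚ w)) =
      hF.theta m W' (tensorMap f ν (PiTensorProduct.tprod ℚ w))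
    rw [tensorMap_tprod, theta_tprod, theta_tprod, ← mapₗ_comp, hat_comp]
  exact LinearMap.congr_fun this t

end action

/-! ### The multilinear part of `⨂ i, W_i^{⊗ μ i}` -/

section tensor

variable {μ ν : GenPartition}

/-- The basis vectors of the tensor powers of a free `𝕊`-module are indexed by such families. -/
abbrev TensorIdx (μ ν : GenPartition) : Type :=
  ∀ y : Idx μ, Fin (ν y.1) × Equiv.Perm (Fin y.1)

/-- The standard basis of a free `𝕊`-module in degree `i`. -/
def freeBasis (ν : GenPartition) (i : ℕ) :
    Module.Basis (Fin (ν i) × Equiv.Perm (Fin i)) ℚ ((freeMod ν).carrier i) :=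
  (Pi.basisFun ℚ (Fin (ν i) × Equiv.Perm (Fin i)) :)

theorem freeBasis_apply (ν : GenPartition) (i : ℕ) (p : Fin (ν i) × Equiv.Perm (Fin i)) :
    freeBasis ν i p = (Pi.single p 1 : Fin (ν i) × Equiv.Perm (Fin i) → ℚ) :=
  Pi.basisFun_apply ℚ _ p

theorem component_scale_freeBasis (t : Idx ν → ℚ) (i : ℕ) (p : Fin (ν i) × Equiv.Perm (Fin i)) :
    component (scale t) i (freeBasis ν i p) = t ⟨i, p.1⟩ • freeBasis ν i p := by
  rw [freeBasis_apply]
  refine (component_scale t i _).trans (funext fun x => ?_)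
  change t ⟨i, x.1⟩ * (Pi.single p 1 : Fin (ν i) × Equiv.Perm (Fin i) → ℚ) x =
    t ⟨i, p.1⟩ * (Pi.single p 1 : Fin (ν i) × Equiv.Perm (Fin i) → ℚ) x
  by_cases hx : x = p
  · rw [hx]
  · simp [hx]

/-- The standard basis of a tensor power of a free `𝕊`-module. -/
def tensorBasis (μ ν : GenPartition) :
    Module.Basis (TensorIdx μ ν) ℚ (TensorSpace (freeMod ν) μ) :=
  Basis.piTensorProduct fun y : Idx μ => freeBasis ν y.1

theorem tensorBasis_apply (p : TensorIdx μ ν) :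
    tensorBasis μ ν p = PiTensorProduct.tprod ℚ fun y : Idx μ => freeBasis ν y.1 (p y) :=
  Basis.piTensorProduct_apply _ p

/-- The generator of the free `𝕊`-module occurring in each factor of a basis vector. -/
def TensorIdx.proj (p : TensorIdx μ ν) (y : Idx μ) : Idx ν := ⟨y.1, (p y).1⟩

theorem tensorMap_scale_tensorBasis (t : Idx ν → ℚ) (p : TensorIdx μ ν) :
    tensorMap (scale t) μ (tensorBasis μ ν p) = (∏ y, t (p.proj y)) • tensorBasis μ ν p := by
  rw [tensorBasis_apply, tensorMap_tprod, ← MultilinearMap.map_smul_univ]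
  simp only [component_scale_freeBasis]
  rfl

theorem repr_tensorMap_scale (t : Idx ν → ℚ) (z : TensorSpace (freeMod ν) μ)
    (p : TensorIdx μ ν) : (tensorBasis μ ν).repr (tensorMap (scale t) μ z) p =
      (∏ y, t (p.proj y)) * (tensorBasis μ ν).repr z p := by
  have : (tensorBasis μ ν).coord p ∘ₗ (tensorMap (scale t) μ).toLinearMap =
      (∏ y, t (p.proj y)) • (tensorBasis μ ν).coord p := by
    refine (tensorBasis μ ν).ext fun p' => ?_
    change (tensorBasis μ ν).coord p (tensorMap (scale t) μ (tensorBasis μ ν p')) = _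
    rw [tensorMap_scale_tensorBasis, map_smul, LinearMap.smul_apply]
    by_cases hp : p' = p
    · rw [hp]
    · simp [hp]
  exact LinearMap.congr_fun this z

theorem bijective_of_forall_prod_eq {X Y : Type*} [Fintype X] [Fintype Y] (q : X → Y)
    (h : ∀ t : Y → ℚ, ∏ x, t (q x) = ∏ y, t y) : Function.Bijective q := by
  classical
  have hs : Function.Surjective q := by
    intro y
    by_contra hy
    push Not at hy
    have := h (Function.update 1 y 0)
    rw [Finset.prod_eq_zero (Finset.mem_univ y) (by simp),
      Finset.prod_eq_one fun x _ => by simp [hy x]] at this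
    exact one_ne_zero this
  refine (Fintype.bijective_iff_surjective_and_card q).2 ⟨hs, ?_⟩
  have := h fun _ => 2
  simp only [Finset.prod_const, Finset.card_univ] at this
  exact pow_right_injective₀ (by norm_num) (by norm_num) this

/-- The multilinear elements of `⨂ i, U_i^{⊗ μ i}` for the free `𝕊`-module `U` on generators
indexed by `ν`. -/
def IsMultilinear (z : TensorSpace (freeMod ν) μ) : Prop :=
  ∀ t : Idx ν → ℚ, tensorMap (scale t) μ z = (∏ y, t y) • z

theorem IsMultilinear.bijective {z : TensorSpace (freeMod ν) μ} (hz : IsMultilinear z)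
    {p : TensorIdx μ ν} (hp : (tensorBasis μ ν).repr z p ≠ 0) : Function.Bijective p.proj := by
  refine bijective_of_forall_prod_eq _ fun t => mul_right_cancel₀ hp ?_
  rw [← repr_tensorMap_scale, hz t]
  simp

theorem TensorIdx.fiber_bijective {p : TensorIdx μ ν} (hp : Function.Bijective p.proj) (i : ℕ) :
    @Function.Bijective (Fin (μ i)) (Fin (ν i)) fun j => (p ⟨i, j⟩).1 := by
  constructor
  · intro j j' h
    have : p.proj ⟨i, j⟩ = p.proj ⟨i, j'⟩ := by
      unfold TensorIdx.proj
      exact congrArg (Sigma.mk i) h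
    simpa using hp.1 this
  · intro k
    obtain ⟨⟨i', j⟩, h⟩ := hp.2 ⟨i, k⟩
    obtain rfl : i' = i := congrArg Sigma.fst h
    exact ⟨j, by simpa [TensorIdx.proj] using h⟩

theorem IsMultilinear.eq_zero {z : TensorSpace (freeMod ν) μ} (hz : IsMultilinear z)
    (h : μ ≠ ν) : z = 0 := by
  refine (tensorBasis μ ν).ext_elem fun p => ?_
  rw [map_zero, Finsupp.zero_apply]
  by_contra hp
  refine h (Finsupp.ext fun i => ?_)
  simpa using Fintype.card_of_bijective (TensorIdx.fiber_bijective (hz.bijective hp) i)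

/-- The tautological element of `⨂ i, U_i^{⊗ ν i}`. -/
def tautological (ν : GenPartition) : TensorSpace (freeMod ν) ν := PiTensorProduct.tprod ℚ (gen ν)

/-- The index of a translate of the tautological element in the standard basis. -/
def translateIdx (g : SGroup ν) : TensorIdx ν ν :=
  fun y => ((g y.1).right⁻¹ y.2, (g y.1).left y.2)

theorem tensorRep_tautological (g : SGroup ν) :
    tensorRep (freeMod ν) ν g (tautological ν) = tensorBasis ν ν (translateIdx g) := by
  rw [tautological, tensorRep_tprod, tensorBasis_apply]
  congr 1
  funext y
  exact (ρ_gen y.1 _ _).trans (freeBasis_apply ν y.1 _).symm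

theorem translateIdx_injective : Function.Injective (translateIdx (ν := ν)) := by
  intro g h hgh
  refine funext fun i => SemidirectProduct.ext (funext fun j => ?_) ?_
  · exact congrArg Prod.snd (congrFun hgh ⟨i, j⟩)
  · refine inv_injective (Equiv.ext fun j => ?_)
    exact congrArg Prod.fst (congrFun hgh ⟨i, j⟩)

theorem exists_translateIdx_eq {p : TensorIdx ν ν} (hp : Function.Bijective p.proj) :
    ∃ g : SGroup ν, translateIdx g = p := by
  refine ⟨fun i => ⟨fun j => (p ⟨i, j⟩).2,
    (Equiv.ofBijective _ (TensorIdx.fiber_bijective hp i))⁻¹⟩, ?_⟩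
  funext y
  refine Prod.ext ?_ rfl
  simp [translateIdx]

/-- The coefficient of the tautological element. -/
def tautologicalCoeff (ν : GenPartition) : TensorSpace (freeMod ν) ν →ₗ[ℚ] ℚ :=
  (tensorBasis ν ν).coord (translateIdx 1)

open scoped Classical in
theorem tautologicalCoeff_translate (g : SGroup ν) :
    tautologicalCoeff ν (tensorRep (freeMod ν) ν g (tautological ν)) = if g = 1 then 1 else 0 := by
  rw [tautologicalCoeff, tensorRep_tautological]
  simp [Finsupp.single_apply, translateIdx_injective.eq_iff]

theorem IsMultilinear.mem_span {z : TensorSpace (freeMod ν) ν} (hz : IsMultilinear z) :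
    z ∈ Submodule.span ℚ (Set.range fun g => tensorRep (freeMod ν) ν g (tautological ν)) := by
  classical
  rw [← (tensorBasis ν ν).sum_repr z]
  refine Submodule.sum_mem _ fun p _ => ?_
  by_cases hp : (tensorBasis ν ν).repr z p = 0
  · rw [hp, zero_smul]
    exact Submodule.zero_mem _
  · obtain ⟨g, rfl⟩ := exists_translateIdx_eq (hz.bijective hp)
    exact Submodule.smul_mem _ _ (Submodule.subset_span ⟨g, tensorRep_tautological g⟩)

theorem IsMultilinear.eq_sum {z : TensorSpace (freeMod ν) ν} (hz : IsMultilinear z) :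
    z = ∑ g, tautologicalCoeff ν (tensorRep (freeMod ν) ν g⁻¹ z) •
      tensorRep (freeMod ν) ν g (tautological ν) := by
  classical
  refine Submodule.span_induction (p := fun z _ => z = ∑ g, tautologicalCoeff ν
    (tensorRep (freeMod ν) ν g⁻¹ z) • tensorRep (freeMod ν) ν g (tautological ν))
    ?_ (by simp) ?_ ?_ hz.mem_span
  · rintro _ ⟨h, rfl⟩
    simp only [← Module.End.mul_apply, ← map_mul, tautologicalCoeff_translate, inv_mul_eq_one]
    simp
  · intro x y _ _ hx hy
    simp only [map_add, add_smul, Finset.sum_add_distrib, ← hx, ← hy]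
  · intro q x _ hx
    simp only [map_smul, smul_assoc, ← Finset.smul_sum, ← hx]

theorem tensorMap_shift_tautological (g : SGroup ν) :
    tensorMap (shift g) ν (tautological ν) = tensorRep (freeMod ν) ν g (tautological ν) := by
  rw [tautological, tensorMap_tprod, tensorRep_tprod, shift]
  simp only [component_hat_gen]

theorem tensorMap_tensorRep {W W' : SMod} (f : W ⟶ W') (g : SGroup ν) (z : TensorSpace W ν) :
    tensorMap f ν (tensorRep W ν g z) = tensorRep W' ν g (tensorMap f ν z) :=
  Representation.IntertwiningMap.isIntertwining _ _ (tensorMap f ν) g z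

theorem IsMultilinear.coeff_tensorMap_shift {z : TensorSpace (freeMod ν) ν} (hz : IsMultilinear z)
    (g : SGroup ν) : tautologicalCoeff ν (tensorMap (shift g) ν z) =
      tautologicalCoeff ν (tensorRep (freeMod ν) ν g z) := by
  classical
  refine Submodule.span_induction (p := fun z _ => tautologicalCoeff ν (tensorMap (shift g) ν z) =
      tautologicalCoeff ν (tensorRep (freeMod ν) ν g z)) ?_ (by simp) ?_ ?_ hz.mem_span
  · rintro _ ⟨h, rfl⟩
    dsimp only
    rw [tensorMap_tensorRep, tensorMap_shift_tautological, ← Module.End.mul_apply,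
      ← Module.End.mul_apply, ← map_mul, ← map_mul, tautologicalCoeff_translate,
      tautologicalCoeff_translate]
    exact if_congr mul_eq_one_comm rfl rfl
  · intro x y _ _ hx hy
    rw [map_add, map_add, map_add, map_add, hx, hy]
  · intro q x _ hx
    rw [map_smul, map_smul, map_smul, map_smul, hx]

theorem isMultilinear_translate (g : SGroup ν) :
    IsMultilinear (tensorRep (freeMod ν) ν g (tautological ν)) := by
  intro t
  rw [tensorMap_tensorRep, tautological, tensorMap_tprod, scale]
  simp only [component_hat_gen]
  rw [MultilinearMap.map_smul_univ, map_smul]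

end tensor

/-! ### The functors `F_V` are bounded polynomial functors -/

section bounded

variable {V V' : S2Mod} {U W : SMod}

/-- The component of an element of `F_V W` in `Hom(V_ν, ⨂ i, W_i^{⊗ ν i})`. -/
def coeff (V : S2Mod) (W : SMod) (ν : GenPartition) :
    (FFunctor V).obj W →ₗ[ℚ] V.carrier ν →ₗ[ℚ] TensorSpace W ν where
  toFun z :=
    have z' : FObj V W := z
    (z' ν).toLinearMap
  map_add' _ _ := rfl
  map_smul' _ _ := rfl

theorem FFunctor_ext {z z' : (FFunctor V).obj W}
    (h : ∀ μ v, coeff V W μ z v = coeff V W μ z' v) : z = z' :=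
  DFinsupp.ext fun μ => Representation.IntertwiningMap.ext (LinearMap.ext (h μ))

theorem coeff_ρ (z : (FFunctor V).obj W) (μ : GenPartition) (g : SGroup μ) (v : V.carrier μ) :
    coeff V W μ z (V.ρ μ g v) = tensorRep W μ g (coeff V W μ z v) :=
  Representation.IntertwiningMap.isIntertwining _ _ ((show FObj V W from z) μ) g v

theorem coeff_mapₗ (f : U ⟶ W) (z : (FFunctor V).obj U) (μ : GenPartition) (v : V.carrier μ) :
    coeff V W μ (mapₗ (FFunctor V) f z) v = tensorMap f μ (coeff V U μ z v) := rfl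

theorem coeff_schurWeylFunctor (a : V' ⟶ V) (z : (FFunctor V).obj W) (μ : GenPartition)
    (v : V'.carrier μ) : coeff V' W μ (appₗ (schurWeylFunctor.map a.op) W z) v =
      coeff V W μ z (component a μ v) := by
  change tensorMap (𝟙 W) μ (coeff V W μ z (component a μ v)) = _
  rw [tensorMap_id]
  rfl

theorem isPolynomialMapOfDegreeLE_tensorMap (ν : GenPartition) (t : TensorSpace U ν) :
    IsPolynomialMapOfDegreeLE (Fintype.card (Idx ν)) fun f : U ⟶ W => tensorMap f ν t :=
  (IsPolynomialMapOfDegreeLE.multilinearMap (PiTensorProduct.mapMultilinear ℚ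
    (fun y : Idx ν => U.carrier y.1) fun y => W.carrier y.1)
    fun y => componentₗ U W y.1).linearMap_comp (LinearMap.applyₗ t)

theorem hasDegreeLE_FFunctor {N : ℕ}
    (hN : ∀ ν, Nontrivial (V.carrier ν) → Fintype.card (Idx ν) ≤ N) :
    HasDegreeLE (FFunctor V) N := by
  intro U W
  let L : ((FFunctor V).obj U ⟶ (FFunctor V).obj W) →ₗ[ℚ]
      ((FFunctor V).obj U → ∀ ν, V.carrier ν → TensorSpace W ν) :=
    { toFun := fun h z ν v => coeff V W ν (h.hom.hom z) v
      map_add' := fun _ _ => rfl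
      map_smul' := fun _ _ => rfl }
  refine IsPolynomialMapOfDegreeLE.of_injective L ?_ ?_
  · intro h h' hh
    refine FGModuleCat.hom_ext (LinearMap.ext fun z => FFunctor_ext fun ν v => ?_)
    exact congrFun (congrFun (congrFun hh z) ν) v
  · refine .pi fun z => .pi fun ν => .pi fun v => ?_
    by_cases h : Nontrivial (V.carrier ν)
    · exact (isPolynomialMapOfDegreeLE_tensorMap ν (coeff V U ν z v)).mono (hN ν h)
    · have := not_nontrivial_iff_subsingleton.1 h
      convert IsPolynomialMapOfDegreeLE.const (E := U ⟶ W) (0 : TensorSpace W ν) using 2 with f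
      change tensorMap f ν (coeff V U ν z v) = 0
      rw [Subsingleton.elim v 0, map_zero, map_zero]

theorem tensorMap_congr {ν : GenPartition} {f g : U ⟶ W}
    (h : ∀ i ∈ ν.support, component f i = component g i) : tensorMap f ν = tensorMap g ν := by
  refine Representation.IntertwiningMap.ext ?_
  refine congrArg PiTensorProduct.map (funext fun y => ?_)
  rw [h y.1 (Finsupp.mem_support_iff.2 y.2.pos.ne')]

theorem exists_bound (V : S2Mod) : ∃ N, (∀ ν, Nontrivial (V.carrier ν) → Fintype.card (Idx ν) ≤ N) ∧
    ∀ ν, Nontrivial (V.carrier ν) → ∀ i ∈ ν.support, i ≤ N := by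
  obtain ⟨a, ha⟩ := (V.finite_support.image fun ν => Fintype.card (Idx ν)).bddAbove
  obtain ⟨b, hb⟩ := (V.finite_support.image fun ν => ν.support.sup id).bddAbove
  refine ⟨max a b, fun ν hν => le_max_of_le_left (ha ⟨ν, hν, rfl⟩), fun ν hν i hi => ?_⟩
  exact le_max_of_le_right ((Finset.le_sup (f := id) hi).trans (hb ⟨ν, hν, rfl⟩))

theorem exists_hasDegreeLE_FFunctor (V : S2Mod) : ∃ N, HasDegreeLE (FFunctor V) N :=
  let ⟨N, h, _⟩ := exists_bound V
  ⟨N, hasDegreeLE_FFunctor h⟩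

theorem boundedPolynomial_FFunctor (V : S2Mod) : boundedPolynomial (FFunctor V) := by
  obtain ⟨N, h, h'⟩ := exists_bound V
  refine ⟨fun U W => ⟨N, hasDegreeLE_FFunctor h U W⟩, N, fun U W =>
    ⟨hasDegreeLE_FFunctor h U W, fun f g hfg => ?_⟩⟩
  refine FGModuleCat.hom_ext (LinearMap.ext fun z => FFunctor_ext fun ν v => ?_)
  change tensorMap f ν (coeff V U ν z v) = tensorMap g ν (coeff V U ν z v)
  by_cases hν : Nontrivial (V.carrier ν)
  · rw [tensorMap_congr fun i hi => hfg i (h' ν hν i hi)]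
  · have := not_nontrivial_iff_subsingleton.1 hν
    rw [Subsingleton.elim v 0, map_zero, map_zero, map_zero]

end bounded

/-! ### The multilinear part of `F_V` -/

section multilinear

variable {V V' : S2Mod} {ν : GenPartition}

/-- The functional on `V_ν` defined by an element of `F_V (freeMod ν)`. -/
def evalTautological (V : S2Mod) (ν : GenPartition) :
    (FFunctor V).obj (freeMod ν) →ₗ[ℚ] Module.Dual ℚ (V.carrier ν) where
  toFun z := tautologicalCoeff ν ∘ₗ coeff V (freeMod ν) ν z
  map_add' z z' := by rw [map_add, LinearMap.comp_add]
  map_smul' q z := by rw [map_smul, LinearMap.comp_smul, RingHom.id_apply]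

theorem evalTautological_apply (z : (FFunctor V).obj (freeMod ν)) (v : V.carrier ν) :
    evalTautological V ν z v = tautologicalCoeff ν (coeff V _ ν z v) := rfl

/-- The equivariant map `v ↦ ∑ g, ξ (g⁻¹ v) • g τ`, where `τ` is the tautological element. -/
def coevalHom (ξ : Module.Dual ℚ (V.carrier ν)) :
    (V.ρ ν).IntertwiningMap (tensorRep (freeMod ν) ν) where
  toFun v := ∑ g, ξ (V.ρ ν g⁻¹ v) • tensorRep (freeMod ν) ν g (tautological ν)
  map_add' v v' := by simp [add_smul, Finset.sum_add_distrib]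
  map_smul' q v := by simp [mul_smul, Finset.smul_sum]
  isIntertwining' h := by
    refine LinearMap.ext fun v => ?_
    simp only [LinearMap.comp_apply, LinearMap.coe_mk, AddHom.coe_mk, map_sum, map_smul]
    refine Fintype.sum_equiv (Equiv.mulLeft h⁻¹) _ _ fun g => ?_
    simp [← Module.End.mul_apply, ← map_mul]

theorem coevalHom_apply (ξ : Module.Dual ℚ (V.carrier ν)) (v : V.carrier ν) :
    coevalHom ξ v = ∑ g, ξ (V.ρ ν g⁻¹ v) • tensorRep (freeMod ν) ν g (tautological ν) := rfl

/-- The element of `F_V (freeMod ν)` corresponding to a functional on `V_ν`. -/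
def coeval (V : S2Mod) (ν : GenPartition) (ξ : Module.Dual ℚ (V.carrier ν)) :
    (FFunctor V).obj (freeMod ν) :=
  show FObj V (freeMod ν) from DirectSum.lof ℚ GenPartition
    (fun μ => (V.ρ μ).IntertwiningMap (tensorRep (freeMod ν) μ)) ν (coevalHom ξ)

theorem coeff_coeval_self (ξ : Module.Dual ℚ (V.carrier ν)) (v : V.carrier ν) :
    coeff V _ ν (coeval V ν ξ) v =
      ∑ g, ξ (V.ρ ν g⁻¹ v) • tensorRep (freeMod ν) ν g (tautological ν) :=
  congrArg (fun φ : (V.ρ ν).IntertwiningMap (tensorRep (freeMod ν) ν) => φ v)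
    (DirectSum.lof_apply (M := fun μ => (V.ρ μ).IntertwiningMap (tensorRep (freeMod ν) μ)) ℚ ν
      (coevalHom ξ))

theorem coeff_coeval_of_ne (ξ : Module.Dual ℚ (V.carrier ν)) {μ : GenPartition} (h : μ ≠ ν)
    (v : V.carrier μ) : coeff V _ μ (coeval V ν ξ) v = 0 :=
  congrArg (fun φ : (V.ρ μ).IntertwiningMap (tensorRep (freeMod ν) μ) => φ v)
    (DirectSum.of_eq_of_ne (β := fun μ => (V.ρ μ).IntertwiningMap (tensorRep (freeMod ν) μ))
      ν μ (coevalHom ξ) h)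

theorem isMultilinear_coeff {z : (FFunctor V).obj (freeMod ν)}
    (hz : z ∈ multilinearSubmodule (FFunctor V) ν) (μ : GenPartition) (v : V.carrier μ) :
    IsMultilinear (coeff V _ μ z v) := fun t => by
  rw [← coeff_mapₗ, hz t, map_smul, LinearMap.smul_apply]

theorem coeval_mem (ξ : Module.Dual ℚ (V.carrier ν)) :
    coeval V ν ξ ∈ multilinearSubmodule (FFunctor V) ν := by
  intro t
  refine FFunctor_ext fun μ v => ?_
  rw [coeff_mapₗ, map_smul, LinearMap.smul_apply]
  by_cases h : μ = ν
  · subst h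
    rw [coeff_coeval_self, map_sum, Finset.smul_sum]
    refine Finset.sum_congr rfl fun g _ => ?_
    rw [map_smul, isMultilinear_translate g t, smul_comm]
  · rw [coeff_coeval_of_ne ξ h, map_zero, smul_zero]

theorem evalTautological_coeval (ξ : Module.Dual ℚ (V.carrier ν)) :
    evalTautological V ν (coeval V ν ξ) = ξ := by
  classical
  refine LinearMap.ext fun v => ?_
  rw [evalTautological_apply, coeff_coeval_self, map_sum]
  simp only [map_smul, tautologicalCoeff_translate]
  simp

theorem coeval_evalTautological {z : (FFunctor V).obj (freeMod ν)}
    (hz : z ∈ multilinearSubmodule (FFunctor V) ν) :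
    coeval V ν (evalTautological V ν z) = z := by
  refine FFunctor_ext fun μ v => ?_
  by_cases h : μ = ν
  · subst h
    rw [coeff_coeval_self]
    refine .trans ?_ (isMultilinear_coeff hz μ v).eq_sum.symm
    refine Finset.sum_congr rfl fun g _ => ?_
    rw [evalTautological_apply, coeff_ρ]
  · rw [coeff_coeval_of_ne _ h]
    exact ((isMultilinear_coeff hz μ v).eq_zero h).symm

theorem evalTautological_injOn {z z' : (FFunctor V).obj (freeMod ν)}
    (hz : z ∈ multilinearSubmodule (FFunctor V) ν) (hz' : z' ∈ multilinearSubmodule (FFunctor V) ν)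
    (h : evalTautological V ν z = evalTautological V ν z') : z = z' := by
  rw [← coeval_evalTautological hz, h, coeval_evalTautological hz']

theorem evalTautological_shift {z : (FFunctor V).obj (freeMod ν)}
    (hz : z ∈ multilinearSubmodule (FFunctor V) ν) (g : SGroup ν) :
    evalTautological V ν (mapₗ (FFunctor V) (shift g) z) =
      evalTautological V ν z ∘ₗ V.ρ ν g := by
  refine LinearMap.ext fun v => ?_
  rw [LinearMap.comp_apply, evalTautological_apply, evalTautological_apply, coeff_mapₗ, coeff_ρ,
    (isMultilinear_coeff hz ν v).coeff_tensorMap_shift]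

theorem evalTautological_schurWeylFunctor (a : V' ⟶ V) (z : (FFunctor V).obj (freeMod ν)) :
    evalTautological V' ν (appₗ (schurWeylFunctor.map a.op) _ z) =
      evalTautological V ν z ∘ₗ (component a ν).toLinearMap :=
  LinearMap.ext fun v => congrArg (tautologicalCoeff ν) (coeff_schurWeylFunctor a z ν v)

/-- `coeval` as a linear map. -/
def coevalₗ (V : S2Mod) (ν : GenPartition) :
    Module.Dual ℚ (V.carrier ν) →ₗ[ℚ] (FFunctor V).obj (freeMod ν) where
  toFun := coeval V ν
  map_add' ξ ξ' := evalTautological_injOn (coeval_mem _)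
    (Submodule.add_mem _ (coeval_mem _) (coeval_mem _)) (by
      rw [map_add, evalTautological_coeval, evalTautological_coeval, evalTautological_coeval])
  map_smul' q ξ := evalTautological_injOn (coeval_mem _)
    (Submodule.smul_mem _ _ (coeval_mem _)) (by
      rw [map_smul, evalTautological_coeval, evalTautological_coeval, RingHom.id_apply])

/-! ### Full faithfulness -/

theorem schurWeylFunctor_map_injective {a b : V' ⟶ V}
    (h : schurWeylFunctor.map a.op = schurWeylFunctor.map b.op) : a = b := by
  refine RepFamily.hom_ext fun ν v => ?_
  refine (Module.evalEquiv ℚ (V.carrier ν)).injective (LinearMap.ext fun ξ => ?_)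
  change ξ (component a ν v) = ξ (component b ν v)
  have h1 := evalTautological_schurWeylFunctor a (coeval V ν ξ)
  rw [h, evalTautological_schurWeylFunctor b, evalTautological_coeval] at h1
  exact (LinearMap.congr_fun h1 v).symm

section full

variable (α : FFunctor V ⟶ FFunctor V')

/-- The map `V'_ν → V_ν` defining a natural transformation `F_V → F_{V'}`. -/
def preimageComponent (ν : GenPartition) : V'.carrier ν →ₗ[ℚ] V.carrier ν :=
  (Module.evalEquiv ℚ (V.carrier ν)).symm.toLinearMap ∘ₗ
    (evalTautological V' ν ∘ₗ appₗ α (freeMod ν) ∘ₗ coevalₗ V ν).dualMap ∘ₗ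
      Module.Dual.eval ℚ (V'.carrier ν)

theorem apply_preimageComponent (ξ : Module.Dual ℚ (V.carrier ν)) (v : V'.carrier ν) :
    ξ (preimageComponent α ν v) = evalTautological V' ν (appₗ α _ (coeval V ν ξ)) v :=
  Module.apply_evalEquiv_symm_apply ..

/-- The morphism `V' ⟶ V` defining a natural transformation `F_V → F_{V'}`. -/
def preimageHom : V' ⟶ V := fun ν =>
  { toLinearMap := preimageComponent α ν
    isIntertwining' := fun g => by
      refine LinearMap.ext fun v => (Module.evalEquiv ℚ (V.carrier ν)).injective
        (LinearMap.ext fun ξ => ?_)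
      change ξ (preimageComponent α ν (V'.ρ ν g v)) = (ξ ∘ₗ V.ρ ν g) (preimageComponent α ν v)
      rw [apply_preimageComponent, apply_preimageComponent]
      have h1 : coeval V ν (ξ ∘ₗ V.ρ ν g) = mapₗ (FFunctor V) (shift g) (coeval V ν ξ) := by
        refine evalTautological_injOn (coeval_mem _) (mapₗ_shift_mem g (coeval_mem _)) ?_
        rw [evalTautological_shift (coeval_mem _), evalTautological_coeval,
          evalTautological_coeval]
      rw [h1, appₗ_mapₗ, evalTautological_shift (appₗ_mem_multilinearSubmodule α (coeval_mem _))]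
      rfl }

theorem schurWeylFunctor_map_preimageHom : schurWeylFunctor.map (preimageHom α).op = α := by
  obtain ⟨N, hN⟩ := exists_hasDegreeLE_FFunctor V
  refine hN.natTrans_ext fun ν z hz => ?_
  refine evalTautological_injOn (appₗ_mem_multilinearSubmodule _ hz)
    (appₗ_mem_multilinearSubmodule _ hz) ?_
  refine (evalTautological_schurWeylFunctor (preimageHom α) z).trans ?_
  refine LinearMap.ext fun v => (apply_preimageComponent α (evalTautological V ν z) v).trans ?_
  rw [coeval_evalTautological hz]
  rfl

end full

end multilinear

/-! ### Essential surjectivity -/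

section essSurj

variable {F : SMod ⥤ FGModuleCat.{0} ℚ} {N : ℕ}

theorem scale_one (ν : GenPartition) : scale (1 : Idx ν → ℚ) = 𝟙 (freeMod ν) := by
  simp [scale, hat_gen]

theorem HasDegreeLE.card_le (hF : HasDegreeLE F N) {ν : GenPartition} {m : F.obj (freeMod ν)}
    (hm : m ∈ multilinearSubmodule F ν) (h0 : m ≠ 0) : Fintype.card (Idx ν) ≤ N := by
  by_contra hlt
  refine h0 ?_
  rw [← multilinearProj_of_mem N hm, multilinearProj]
  obtain ⟨S, c, hS, hc⟩ := hF.exists_scale_expansion m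
  simp only [hc]
  rw [multilinearPart_sum]
  refine Finset.sum_eq_zero fun k hk => ?_
  rw [multilinearPart_smul, multilinearPart_monomial, if_neg, zero_smul]
  · rintro rfl
    have := hS _ hk
    simp only [Pi.one_apply, Finset.sum_const, Finset.card_univ, smul_eq_mul, mul_one] at this
    exact hlt this
  · exact fun y => (Finset.single_le_sum (fun _ _ => Nat.zero_le _) (Finset.mem_univ y)).trans
      ((hS k hk).trans (Nat.le_succ N))

theorem le_of_mem_support
    (hF : ∀ (U W : SMod) (f g : U ⟶ W), (∀ n ≤ N, component f n = component g n) →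
      F.map f = F.map g) {ν : GenPartition} {m : F.obj (freeMod ν)}
    (hm : m ∈ multilinearSubmodule F ν) (h0 : m ≠ 0) {i : ℕ} (hi : i ∈ ν.support) : i ≤ N := by
  classical
  by_contra hlt
  let y : Idx ν := ⟨i, ⟨0, Nat.pos_of_ne_zero (Finsupp.mem_support_iff.1 hi)⟩⟩
  have h1 : F.map (scale (Function.update 1 y 0)) = F.map (scale (1 : Idx ν → ℚ)) := by
    refine hF _ _ _ _ fun n hn => Representation.IntertwiningMap.ext (LinearMap.ext fun f => ?_)
    refine (component_scale _ n f).trans (.trans ?_ (component_scale _ n f).symm)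
    funext p
    rw [Function.update_of_ne]
    intro h
    obtain rfl : n = i := congrArg Sigma.fst h
    exact hlt hn
  have h2 : mapₗ F (scale (Function.update 1 y 0)) m = mapₗ F (scale (1 : Idx ν → ℚ)) m := by
    rw [mapₗ, h1, mapₗ]
  rw [hm, scale_one, mapₗ_id, Finset.prod_eq_zero (Finset.mem_univ y) (by simp), zero_smul] at h2
  exact h0 h2.symm

theorem apply_le_card (ν : GenPartition) (i : ℕ) : ν i ≤ Fintype.card (Idx ν) := by
  simpa using Fintype.card_le_of_injective (fun j : Fin (ν i) => (⟨i, j⟩ : Idx ν))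
    fun j j' h => by simpa using h

theorem finite_multilinearSubmodule (hF : HasDegreeLE F N)
    (hF' : ∀ (U W : SMod) (f g : U ⟶ W), (∀ n ≤ N, component f n = component g n) →
      F.map f = F.map g) :
    {ν | Nontrivial (Module.Dual ℚ (multilinearSubmodule F ν))}.Finite := by
  refine (Set.finite_Iic (Finsupp.indicator (Finset.range (N + 1)) fun _ _ => N)).subset ?_
  intro ν hν i
  have : Nontrivial (multilinearSubmodule F ν) := by
    by_contra h
    have := not_nontrivial_iff_subsingleton.1 h
    exact not_subsingleton_iff_nontrivial.2 hν inferInstance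
  obtain ⟨m, hm⟩ := exists_ne (0 : multilinearSubmodule F ν)
  have hm0 : (m : F.obj (freeMod ν)) ≠ 0 := fun h => hm (Subtype.ext h)
  by_cases hi : i ∈ ν.support
  · rw [Finsupp.indicator_of_mem (Finset.mem_range_succ_iff.2 (le_of_mem_support hF' m.2 hm0 hi))]
    exact (apply_le_card ν i).trans (hF.card_le m.2 hm0)
  · rw [Finsupp.notMem_support_iff.1 hi]
    exact Nat.zero_le _

/-- The `𝕊^{[2]}`-module of a bounded polynomial functor. -/
def dualMultilinear (F : SMod ⥤ FGModuleCat.{0} ℚ)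
    (hfin : {ν | Nontrivial (Module.Dual ℚ (multilinearSubmodule F ν))}.Finite) : S2Mod where
  carrier ν := Module.Dual ℚ (multilinearSubmodule F ν)
  ρ := dualMultilinearRep F
  finite_support := hfin

variable (hfin : {ν | Nontrivial (Module.Dual ℚ (multilinearSubmodule F ν))}.Finite)
  (hF : HasDegreeLE F N)

/-- A basis of the multilinear part of `F (freeMod ν)`. -/
abbrev multilinearBasis (F : SMod ⥤ FGModuleCat.{0} ℚ) (ν : GenPartition) :
    Module.Basis (Fin (Module.finrank ℚ (multilinearSubmodule F ν))) ℚ (multilinearSubmodule F ν) :=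
  Module.finBasis ℚ _

/-- The contraction `Hom(M^*, ⨂ i, W_i^{⊗ ν i}) ≅ M ⊗ ⨂ i, W_i^{⊗ ν i} → F W`, where `M` is the
multilinear part of `F (freeMod ν)`. -/
def contraction (W : SMod) (ν : GenPartition) :
    ((dualMultilinear F hfin).ρ ν).IntertwiningMap (tensorRep W ν) →ₗ[ℚ] F.obj W where
  toFun φ := ∑ k, hF.theta (multilinearBasis F ν k) W (φ ((multilinearBasis F ν).coord k))
  map_add' φ ψ := by
    rw [← Finset.sum_add_distrib]
    exact Finset.sum_congr rfl fun k _ => map_add (hF.theta (multilinearBasis F ν k) W) _ _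
  map_smul' q φ := by
    rw [RingHom.id_apply, Finset.smul_sum]
    exact Finset.sum_congr rfl fun k _ => map_smul (hF.theta (multilinearBasis F ν k) W) _ _

theorem contraction_apply (W : SMod) (ν : GenPartition)
    (φ : ((dualMultilinear F hfin).ρ ν).IntertwiningMap (tensorRep W ν)) :
    contraction hfin hF W ν φ =
      ∑ k, hF.theta (multilinearBasis F ν k) W (φ ((multilinearBasis F ν).coord k)) := rfl

/-- The natural transformation `F_V → F` for the `𝕊^{[2]}`-module `V` of `F`. -/
def comparison : FFunctor (dualMultilinear F hfin) ⟶ F where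
  app W := FGModuleCat.ofHom (DirectSum.toModule ℚ GenPartition (F.obj W) (contraction hfin hF W))
  naturality W W' f := by
    refine FGModuleCat.hom_ext ?_
    change DirectSum.toModule ℚ GenPartition (F.obj W') (contraction hfin hF W') ∘ₗ
        FMap (𝟙 (dualMultilinear F hfin)) f =
      mapₗ F f ∘ₗ DirectSum.toModule ℚ GenPartition (F.obj W) (contraction hfin hF W)
    refine DirectSum.linearMap_ext ℚ fun ν => LinearMap.ext fun φ => ?_
    rw [LinearMap.comp_apply, LinearMap.comp_apply, LinearMap.comp_apply, LinearMap.comp_apply,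
      FMap, DirectSum.lmap_lof, DirectSum.toModule_lof, DirectSum.toModule_lof,
      contraction_apply, contraction_apply, map_sum]
    refine Finset.sum_congr rfl fun k _ => ?_
    rw [hF.mapₗ_theta]
    rfl

/-- Evaluation at an element of the multilinear part. -/
def evalFunctional {ν : GenPartition} (m : multilinearSubmodule F ν) :
    Module.Dual ℚ ((dualMultilinear F hfin).carrier ν) :=
  Module.Dual.eval ℚ (multilinearSubmodule F ν) m

theorem evalFunctional_surjective {ν : GenPartition}
    (ξ : Module.Dual ℚ ((dualMultilinear F hfin).carrier ν)) :
    ∃ m, evalFunctional hfin m = ξ :=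
  (Module.evalEquiv ℚ (multilinearSubmodule F ν)).surjective ξ

theorem comparison_coeval {ν : GenPartition} (m : multilinearSubmodule F ν) :
    appₗ (comparison hfin hF) (freeMod ν)
      (coeval (dualMultilinear F hfin) ν (evalFunctional hfin m)) =
      (Fintype.card (SGroup ν) : ℚ) • (m : F.obj (freeMod ν)) := by
  have h1 : appₗ (comparison hfin hF) (freeMod ν)
      (coeval (dualMultilinear F hfin) ν (evalFunctional hfin m)) =
      contraction hfin hF (freeMod ν) ν (coevalHom (evalFunctional hfin m)) :=
    DirectSum.toModule_lof ℚ ν _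
  have h2 : ∀ (g : SGroup ν) k, hF.theta (multilinearBasis F ν k) (freeMod ν)
      (tensorRep (freeMod ν) ν g (tautological ν)) =
      mapₗ F (shift g) (multilinearBasis F ν k : F.obj (freeMod ν)) := fun g k => by
    rw [tautological, tensorRep_tprod, hF.theta_tprod, shift]
  have h3 : ∀ k, hF.theta (multilinearBasis F ν k) (freeMod ν)
      (coevalHom (evalFunctional hfin m) ((multilinearBasis F ν).coord k)) =
      ∑ g, mapₗ F (shift g) ((multilinearBasis F ν).coord k (shiftₗ F g⁻¹ m) •
        (multilinearBasis F ν k : F.obj (freeMod ν))) := fun k => by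
    refine (congrArg (hF.theta (multilinearBasis F ν k) (freeMod ν))
      (coevalHom_apply (evalFunctional hfin m) ((multilinearBasis F ν).coord k))).trans ?_
    rw [map_sum]
    refine Finset.sum_congr rfl fun g _ => ?_
    rw [map_smul, map_smul, h2]
    rfl
  rw [h1, contraction_apply, Finset.sum_congr rfl fun k _ => h3 k, Finset.sum_comm,
    ← Finset.card_univ, Nat.cast_smul_eq_nsmul, ← Finset.sum_const]
  refine Finset.sum_congr rfl fun g _ => ?_
  have h4 := congrArg (multilinearSubmodule F ν).subtype
    ((multilinearBasis F ν).sum_repr (shiftₗ F g⁻¹ m))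
  rw [map_sum] at h4
  simp only [map_smul] at h4
  rw [← map_sum]
  refine (congrArg (mapₗ F (shift g)) h4).trans ?_
  change mapₗ F (shift g) (mapₗ F (shift g⁻¹) (m : F.obj (freeMod ν))) = _
  rw [← mapₗ_comp, ← shift_mul, inv_mul_cancel, shift_one, mapₗ_id]

theorem isIso_comparison : IsIso (comparison hfin hF) := by
  obtain ⟨N', hN'⟩ := exists_hasDegreeLE_FFunctor (dualMultilinear F hfin)
  have hcard : ∀ ν, (Fintype.card (SGroup ν) : ℚ) ≠ 0 := fun ν => by
    exact_mod_cast Fintype.card_ne_zero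
  refine isIso_of_bijective _ fun W => ⟨hN'.appₗ_injective _ (fun ν z hz h0 => ?_) W,
    hF.appₗ_surjective _ (fun ν m hm => ?_) W⟩
  · obtain ⟨m, hm⟩ := evalFunctional_surjective hfin (evalTautological _ ν z)
    have hz' := coeval_evalTautological hz
    rw [← hm] at hz'
    have h1 := comparison_coeval hfin hF m
    have h2 : (m : F.obj (freeMod ν)) = 0 :=
      (smul_eq_zero.1 (h1.symm.trans ((congrArg _ hz').trans h0))).resolve_left (hcard ν)
    rw [← hz', show m = 0 from Subtype.ext h2]
    exact (congrArg _ (map_zero _)).trans (map_zero (coevalₗ (dualMultilinear F hfin) ν))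
  · refine ⟨(Fintype.card (SGroup ν) : ℚ)⁻¹ •
      coeval (dualMultilinear F hfin) ν (evalFunctional hfin ⟨m, hm⟩), ?_⟩
    rw [map_smul, comparison_coeval, smul_smul, inv_mul_cancel₀ (hcard ν), one_smul]

end essSurj

theorem exists_iso_FFunctor {F : SMod ⥤ FGModuleCat.{0} ℚ} (hF : boundedPolynomial F) :
    ∃ V : S2Mod, Nonempty (FFunctor V ≅ F) := by
  obtain ⟨N, hN⟩ := hF.2
  have hdeg : HasDegreeLE F N := fun U W => (hN U W).1
  have hfin := finite_multilinearSubmodule hdeg fun U W => (hN U W).2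
  have := isIso_comparison hfin hdeg
  exact ⟨dualMultilinear F hfin, ⟨asIso (comparison hfin hdeg)⟩⟩

instance : schurWeylFunctor.Faithful where
  map_injective h := Quiver.Hom.unop_inj (schurWeylFunctor_map_injective h)

instance : schurWeylFunctor.Full where
  map_surjective α := ⟨(preimageHom α).op, schurWeylFunctor_map_preimageHom α⟩

/-- `V ↦ F_V` as a functor to bounded polynomial functors. -/
def polySchurWeylFunctor : S2Modᵒᵖ ⥤ PolyFun :=
  boundedPolynomial.lift schurWeylFunctor fun V => boundedPolynomial_FFunctor V.unop

instance : polySchurWeylFunctor.Faithful :=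
  Functor.Faithful.of_comp_iso (F := polySchurWeylFunctor) (G := boundedPolynomial.ι)
    (boundedPolynomial.liftCompιIso _ _)

instance : polySchurWeylFunctor.Full :=
  Functor.Full.of_comp_faithful_iso (F := polySchurWeylFunctor) (G := boundedPolynomial.ι)
    (boundedPolynomial.liftCompιIso _ _)

instance : polySchurWeylFunctor.EssSurj where
  mem_essImage F := by
    obtain ⟨V, ⟨e⟩⟩ := exists_iso_FFunctor F.property
    exact ⟨Opposite.op V, ⟨boundedPolynomial.isoMk e⟩⟩

instance : polySchurWeylFunctor.IsEquivalence where

/-! ### Self-duality of finite-dimensional rational representations -/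

theorem exists_invariant_equiv_dual {G : Type} [Group G] [Finite G] {M : Type} [AddCommGroup M]
    [Module ℚ M] [Module.Finite ℚ M] (ρ : Representation ℚ G M) :
    ∃ B : M ≃ₗ[ℚ] Module.Dual ℚ M, (∀ v w, B v w = B w v) ∧
      ∀ g v w, B (ρ g v) (ρ g w) = B v w := by
  have := Fintype.ofFinite G
  let b := Module.finBasis ℚ M
  let B : M →ₗ[ℚ] Module.Dual ℚ M := LinearMap.mk₂ ℚ
    (fun v w => ∑ g, ∑ k, b.repr (ρ g v) k * b.repr (ρ g w) k)
    (fun v v' w => by simp [add_mul, Finset.sum_add_distrib])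
    (fun q v w => by simp [Finset.mul_sum, mul_assoc])
    (fun v w w' => by simp [mul_add, Finset.sum_add_distrib])
    (fun q v w => by simp [Finset.mul_sum, mul_left_comm])
  have hB : ∀ v w, B v w = ∑ g, ∑ k, b.repr (ρ g v) k * b.repr (ρ g w) k := fun v w => rfl
  have hinj : Function.Injective B := by
    rw [injective_iff_map_eq_zero]
    intro v hv
    have h := hB v v
    rw [hv, LinearMap.zero_apply, eq_comm, Finset.sum_eq_zero_iff_of_nonneg
      fun g _ => Finset.sum_nonneg fun k _ => mul_self_nonneg _] at h
    have h1 := h 1 (Finset.mem_univ 1)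
    rw [Finset.sum_eq_zero_iff_of_nonneg fun k _ => mul_self_nonneg _] at h1
    refine b.ext_elem fun k => ?_
    simpa using h1 k (Finset.mem_univ k)
  refine ⟨LinearEquiv.ofInjectiveOfFinrankEq B hinj Subspace.dual_finrank_eq.symm, ?_, ?_⟩
  · intro v w
    change B v w = B w v
    simp only [hB, mul_comm]
  · intro h v w
    change B (ρ h v) (ρ h w) = B v w
    rw [hB, hB]
    refine Fintype.sum_equiv (Equiv.mulRight h) _ _ fun g => ?_
    simp

section dagger

variable (V : S2Mod)

/-- An invariant inner product on `V_ν`. -/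
def innerEquiv (ν : GenPartition) : V.carrier ν ≃ₗ[ℚ] Module.Dual ℚ (V.carrier ν) :=
  (exists_invariant_equiv_dual (V.ρ ν)).choose

theorem innerEquiv_symm (ν : GenPartition) (v w : V.carrier ν) :
    innerEquiv V ν v w = innerEquiv V ν w v :=
  (exists_invariant_equiv_dual (V.ρ ν)).choose_spec.1 v w

theorem innerEquiv_ρ (ν : GenPartition) (g : SGroup ν) (v w : V.carrier ν) :
    innerEquiv V ν (V.ρ ν g v) (V.ρ ν g w) = innerEquiv V ν v w :=
  (exists_invariant_equiv_dual (V.ρ ν)).choose_spec.2 g v w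

variable {V} {V' V'' : S2Mod}

/-- The adjoint of a morphism on a component. -/
def adjointComponent (f : V ⟶ V') (ν : GenPartition) : V'.carrier ν →ₗ[ℚ] V.carrier ν :=
  (innerEquiv V ν).symm.toLinearMap ∘ₗ (component f ν).toLinearMap.dualMap ∘ₗ
    (innerEquiv V' ν).toLinearMap

theorem innerEquiv_adjointComponent (f : V ⟶ V') (ν : GenPartition) (w : V'.carrier ν)
    (v : V.carrier ν) :
    innerEquiv V ν (adjointComponent f ν w) v = innerEquiv V' ν w (component f ν v) := by
  simp [adjointComponent]

theorem innerEquiv_ext {ν : GenPartition} {v v' : V.carrier ν}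
    (h : ∀ w, innerEquiv V ν v w = innerEquiv V ν v' w) : v = v' :=
  (innerEquiv V ν).injective (LinearMap.ext h)

/-- The adjoint of a morphism. -/
def adjoint (f : V ⟶ V') : V' ⟶ V := fun ν =>
  { toLinearMap := adjointComponent f ν
    isIntertwining' := fun g => by
      refine LinearMap.ext fun w => innerEquiv_ext fun v => ?_
      rw [LinearMap.comp_apply, LinearMap.comp_apply, innerEquiv_adjointComponent,
        ← innerEquiv_ρ V ν g⁻¹, ← innerEquiv_ρ V' ν g⁻¹, ← component_ρ]
      simp [innerEquiv_adjointComponent] }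

theorem innerEquiv_adjoint (f : V ⟶ V') (ν : GenPartition) (w : V'.carrier ν)
    (v : V.carrier ν) :
    innerEquiv V ν (component (adjoint f) ν w) v = innerEquiv V' ν w (component f ν v) :=
  innerEquiv_adjointComponent f ν w v

theorem adjoint_adjoint (f : V ⟶ V') : adjoint (adjoint f) = f := by
  refine RepFamily.hom_ext fun ν v => innerEquiv_ext fun w => ?_
  rw [innerEquiv_adjoint, innerEquiv_symm, innerEquiv_adjoint, innerEquiv_symm]

theorem adjoint_id : adjoint (𝟙 V) = 𝟙 V := by
  refine RepFamily.hom_ext fun ν v => innerEquiv_ext fun w => ?_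
  rw [innerEquiv_adjoint, component_id, component_id]

theorem adjoint_comp (f : V ⟶ V') (g : V' ⟶ V'') : adjoint (f ≫ g) = adjoint g ≫ adjoint f := by
  refine RepFamily.hom_ext fun ν v => innerEquiv_ext fun w => ?_
  rw [innerEquiv_adjoint, component_comp, component_comp, innerEquiv_adjoint, innerEquiv_adjoint]

end dagger

/-- The self-duality of the category of `𝕊^{[2]}`-modules, which is the identity on objects. -/
def adjointFunctor : S2Mod ⥤ S2Modᵒᵖ where
  obj V := Opposite.op V
  map f := (adjoint f).op
  map_id V := by rw [adjoint_id, op_id]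
  map_comp f g := by rw [adjoint_comp, op_comp]

instance : adjointFunctor.Faithful where
  map_injective {V V'} f g h := by
    have h1 : adjoint f = adjoint g := Quiver.Hom.op_inj h
    rw [← adjoint_adjoint f, h1, adjoint_adjoint]

instance : adjointFunctor.Full where
  map_surjective f := ⟨adjoint f.unop, congrArg Quiver.Hom.op (adjoint_adjoint f.unop)⟩

instance : adjointFunctor.EssSurj where
  mem_essImage V := ⟨V.unop, ⟨Iso.refl _⟩⟩

instance : adjointFunctor.IsEquivalence where

end SchurWeyl

end

theorem mainTheorem5 :
    (∃ E : SchurWeyl.S2Modᵒᵖ ≌ SchurWeyl.PolyFun,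
      Nonempty (E.functor ⋙ SchurWeyl.boundedPolynomial.ι ≅ SchurWeyl.schurWeylFunctor)) ∧
    (∃ E : SchurWeyl.S2Mod ≌ SchurWeyl.PolyFun,
      ∀ V : SchurWeyl.S2Mod,
        Nonempty ((E.functor.obj V).obj ≅ SchurWeyl.FFunctor V)) :=
  ⟨⟨SchurWeyl.polySchurWeylFunctor.asEquivalence,
    ⟨SchurWeyl.boundedPolynomial.liftCompιIso _ _⟩⟩,
    (SchurWeyl.adjointFunctor ⋙ SchurWeyl.polySchurWeylFunctor).asEquivalence,
    fun _ => ⟨Iso.refl _⟩⟩
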